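/- **Setting.** Let $\mathcal X=[0,1]^p$, let $F$ be a probability distribution on $\mathcal X$, let $\Theta\subset\mathbb R^d$ be bounded, and let $g_\theta(x)=\eta(x,\theta)$ be a known simulator. For each $n$ the design points $x_1,\dots,x_n\in\mathcal X$ are fixed (they may change with $n$), with empirical distribution $F_n$, and $y_i=\zeta(x_i)+\varepsilon_i$. Write $\|\cdot\|_n$, $\|\cdot\|$ for the $L_2(F_n)$- and $L_2(F)$-norms. Let $\theta_0$ be the unique minimizer over $\Theta$ of $M(\theta)=\|\zeta-g_\theta\|^2<\infty$ (if $\Theta$ is not closed, assume also that $M(\theta)\not\to M(\theta_0)$ as $\theta\in\Theta$ tends to a point of $\overline\Theta\setminus\Theta$), and put $\delta_0=\zeta-g_{\theta_0}$. Let $\mathcal H$ be a cone of functions $\mathcal X\to\mathbb R$ with $\delta_0\in\mathcal H$, let $J:\mathcal H\to[0,\infty)$ be a pseudo-norm, $v>0$, $\lambda_n>0$, and let $$\hat\theta_n\in\operatorname*{argmin}_{\theta\in\Theta}\frac1n\sum_{i=1}^n\{y_i-g_\theta(x_i)\}^2,\qquad \hat\delta_n\in\operatorname*{argmin}_{\delta\in\mathcal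 H}\Big[\frac1n\sum_{i=1}^n\{y_i-g_{\hat\theta_n}(x_i)-\delta(x_i)\}^2+\lambda_n^2J^v(\delta)\Big].$$ **Assumptions.** 1. For each $n$ the errors are independent with $\mathbb E\varepsilon_i=0$, $\mathbb E\varepsilon_i^2=\sigma^2$, and for some $K>0$, $\sigma_0$ (independent of $n$) $K^2\{\mathbb E\exp(\varepsilon_i^2/K^2)-1\}\le\sigma_0^2$ for all $i\le n$. 2. There is $c_0>0$, independent of $n$, with $\|g_\theta-g_{\theta'}\|_n\le c_0\|\theta-\theta'\|_E$ for all $\theta,\theta'\in\Theta$. On a neighbourhood $U$ of $\theta_0$ in $\mathbb R^d$, $g_\theta$ is twice continuously differentiable in $\theta$, and the first and second derivatives $g^{(1)}_\theta(x)$, $g^{(2)}_\theta(x)$ in $\theta$ are continuous in $(x,\theta)\in\mathcal X\times U$ and bounded there. 3. $\sup_{\theta\in\Theta}\big|\|\zeta-g_\theta\|_n^2-\|\zeta-g_\theta\|^2\big|=o(1)$; the matrices $A_n=\int(g^{(1)}_{\theta_0}g^{(1)\top}_{\theta_0}-\delta_0g^{(2)}_{\theta_0})\,dF_n$ converge entrywise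 to $A=\int(g^{(1)}_{\theta_0}g^{(1)\top}_{\theta_0}-\delta_0g^{(2)}_{\theta_0})\,dF$; the Euclidean norm of $\int\delta_0g^{(1)}_{\theta_0}\,dF_n$ is $O(n^{-1/2})$; and $A$ is strictly positive definite. 4. $\delta_0$ is bounded. With $\tilde{\mathcal H}=\big\{\frac{\delta-\delta_0}{J(\delta)+J(\delta_0)}:\delta\in\mathcal H,\ J(\delta)+J(\delta_0)>0\big\}$, there are $K_1>0$ and $0<\alpha<2$ such that $H(u,\tilde{\mathcal H},F_n)\le K_1u^{-\alpha}$ for all $u>0$, $n\ge1$, where $H(u,\cdot,F_n)$ is the logarithm of the smallest number of $L_2(F_n)$-balls of radius $u$ (with arbitrary centres) that cover the class; and $\sup_{n\ge1}\sup_{\gamma\in\tilde{\mathcal H}}\|\gamma\|_n<\infty$. **Theorem.** Under these assumptions let $v>2\alpha/(2+\alpha)$. (i) If $J(\delta_0)>0$ and $\lambda_n\asymp n^{-1/(2+\alpha)}$, then $\|\hat\delta_n-\delta_0\|_n=O_p(n^{-1/(2+\alpha)})$. (ii) If $J(\delta_0)=0$ and $J(\delta)>0$ for all $\delta\in\mathcal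 H\setminus\{\delta_0\}$, then $$\|\hat\delta_n-\delta_0\|_n=O_p\Big(\max\big\{n^{-1/2},\ \lambda_n^{-2\alpha/(2v-2\alpha+v\alpha)}\,n^{-v/(2v-2\alpha+v\alpha)}\big\}\Big).$$ -/

import Mathlib

open Filter Topology MeasureTheory ProbabilityTheory Asymptotics

noncomputable section

namespace Calibration

/-- The input space `[0,1]^p`. -/
abbrev Cube (p : ℕ) : Type := Set.Icc (0 : Fin p → ℝ) 1

/-- The Euclidean space `ℝ^d` of model parameters. -/
abbrev Param (d : ℕ) : Type := EuclideanSpace ℝ (Fin d)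

/-- `X n = O_p(r n)`. The random quantities need not be measurable: `P` is then the outer measure. -/
def IsBigOp {Ω : Type*} [MeasurableSpace Ω] (P : Measure Ω) (X : ℕ → Ω → ℝ) (r : ℕ → ℝ) : Prop :=
  ∀ e : ℝ, 0 < e → ∃ C : ℝ, 0 < C ∧ ∀ᶠ n in atTop, P {ω | C * r n < |X n ω|} ≤ ENNReal.ofReal e

section Empirical

variable {X : Type*}

/-- The norm of `L₂(F_n)`, where `F_n` is the empirical distribution of the design points
`x 0, …, x (n-1)`. -/
def empNorm {n : ℕ} (x : Fin n → X) (f : X → ℝ) : ℝ :=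
  √((n : ℝ)⁻¹ * ∑ i, f (x i) ^ 2)

/-- The smallest number of closed `L₂(F_n)`-balls of radius `u` that cover `G` (the centres need
not belong to `G`); it is `⊤` if there is no finite cover. -/
def coveringNumber {n : ℕ} (x : Fin n → X) (G : Set (X → ℝ)) (u : ℝ) : ℕ∞ :=
  sInf {N : ℕ∞ | ∃ m : ℕ, N = m ∧
    ∃ c : Fin m → X → ℝ, ∀ γ ∈ G, ∃ j, empNorm x (fun t => γ t - c j t) ≤ u}

/-- The `u`-entropy `H(u, G, F_n)` for the `L₂(F_n)`-metric: the logarithm of the covering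
number. -/
def entropy {n : ℕ} (x : Fin n → X) (G : Set (X → ℝ)) (u : ℝ) : EReal :=
  ENNReal.log (ENat.toENNReal (coveringNumber x G u))

/-- The class `H` is a cone. -/
def IsCone (H : Set (X → ℝ)) : Prop :=
  ∀ f ∈ H, ∀ c : ℝ, 0 < c → c • f ∈ H

/-- `J` is a (finite) pseudo-norm on the cone `H`; only its values on `H` matter. -/
structure IsPseudoNormOn (H : Set (X → ℝ)) (J : (X → ℝ) → ℝ) : Prop where
  nonneg : ∀ f ∈ H, 0 ≤ J f
  smul : ∀ f ∈ H, ∀ c : ℝ, c • f ∈ H → J (c • f) = |c| * J f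
  add_le : ∀ f ∈ H, ∀ g ∈ H, f + g ∈ H → J (f + g) ≤ J f + J g

/-- The normalized class `{(δ - δ₀) / (J(δ) + J(δ₀)) : δ ∈ H, J(δ) + J(δ₀) > 0}`. -/
def normalizedClass (H : Set (X → ℝ)) (J : (X → ℝ) → ℝ) (δ₀ : X → ℝ) : Set (X → ℝ) :=
  {γ | ∃ δ ∈ H, 0 < J δ + J δ₀ ∧ γ = fun t => (δ t - δ₀ t) / (J δ + J δ₀)}

end Empirical

/-- Error structure: in each row, independent errors with mean `0` and common variance `σ²`,
which are sub-Gaussian uniformly over all rows. -/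
structure ErrorAssumption {Ω : Type*} [MeasurableSpace Ω] (P : Measure Ω)
    (ε : (n : ℕ) → Fin n → Ω → ℝ) : Prop where
  measurable : ∀ n i, Measurable (ε n i)
  indep : ∀ n, iIndepFun (ε n) P
  mean_zero : ∀ n i, Integrable (ε n i) P ∧ ∫ ω, ε n i ω ∂P = 0
  variance : ∃ σ : ℝ, ∀ n i, Integrable (fun ω => ε n i ω ^ 2) P ∧ ∫ ω, ε n i ω ^ 2 ∂P = σ ^ 2
  subGaussian : ∃ K σ₀ : ℝ, 0 < K ∧ ∀ n i,
    Integrable (fun ω => Real.exp (ε n i ω ^ 2 / K ^ 2)) P ∧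
      K ^ 2 * ((∫ ω, Real.exp (ε n i ω ^ 2 / K ^ 2) ∂P) - 1) ≤ σ₀ ^ 2

section Model

variable {p d : ℕ}

/-- The first derivative of `θ ↦ η(x, θ)`, as a column vector. -/
def grad (η : Cube p → Param d → ℝ) (θ : Param d) (x : Cube p) : Param d :=
  gradient (η x) θ

/-- The second derivative of `θ ↦ η(x, θ)`, as a matrix. -/
def hess (η : Cube p → Param d → ℝ) (θ : Param d) (x : Cube p) : Matrix (Fin d) (Fin d) ℝ :=
  Matrix.of fun j k => fderiv ℝ (fderiv ℝ (η x)) θ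
    (EuclideanSpace.single j 1) (EuclideanSpace.single k 1)

/-- The discrepancy function `ζ - η(·, θ₀)`. -/
def discrepancy (ζ : Cube p → ℝ) (η : Cube p → Param d → ℝ) (θ₀ : Param d) : Cube p → ℝ :=
  fun x => ζ x - η x θ₀

/-- The population criterion `M(θ) = ∫ (ζ(x) - η(x, θ))² dF(x)`. -/
def popRisk (F : Measure (Cube p)) (ζ : Cube p → ℝ) (η : Cube p → Param d → ℝ)
    (θ : Param d) : ℝ :=
  ∫ x, (ζ x - η x θ) ^ 2 ∂F

/-- `θ₀` is the unique minimizer of `M` over `Θ`, for finite `M`. The last clause, void when `Θ` is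
closed, says that the minimum is not approached at points that are missing from `Θ` either. -/
structure IsTrueParam (F : Measure (Cube p)) (ζ : Cube p → ℝ) (η : Cube p → Param d → ℝ)
    (Θ : Set (Param d)) (θ₀ : Param d) : Prop where
  memLp : ∀ θ ∈ Θ, MemLp (fun x => ζ x - η x θ) 2 F
  mem : θ₀ ∈ Θ
  lt_of_ne : ∀ θ ∈ Θ, θ ≠ θ₀ → popRisk F ζ η θ₀ < popRisk F ζ η θ
  not_tendsto : ∀ θ' ∈ closure Θ \ Θ,
    ¬ Tendsto (popRisk F ζ η) (𝓝[Θ] θ') (𝓝 (popRisk F ζ η θ₀))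

/-- Assumptions on the simulator: Lipschitz continuity in `L₂(F_n)`, and, near `θ₀`, derivatives up
to order two in `θ` that are continuous (in input and parameter) and bounded. -/
structure SimulatorAssumption (x : (n : ℕ) → Fin n → Cube p) (η : Cube p → Param d → ℝ)
    (Θ : Set (Param d)) (θ₀ : Param d) : Prop where
  lipschitz : ∃ c₀ : ℝ, 0 < c₀ ∧ ∀ n, 1 ≤ n → ∀ θ ∈ Θ, ∀ θ' ∈ Θ,
    empNorm (x n) (fun t => η t θ - η t θ') ≤ c₀ * ‖θ - θ'‖
  smooth : ∃ U : Set (Param d), IsOpen U ∧ θ₀ ∈ U ∧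
    (∀ t, ContDiffOn ℝ 2 (η t) U) ∧
    ContinuousOn (fun q : Cube p × Param d => grad η q.2 q.1) (Set.univ ×ˢ U) ∧
    ContinuousOn (fun q : Cube p × Param d => hess η q.2 q.1) (Set.univ ×ˢ U) ∧
    ∃ C : ℝ, ∀ t, ∀ θ ∈ U, ‖grad η θ t‖ ≤ C ∧ ∀ j k, |hess η θ t j k| ≤ C

/-- The matrix `A = ∫ g⁽¹⁾ g⁽¹⁾ᵀ - δ₀ g⁽²⁾ dF` at `θ₀`. -/
def popHess (F : Measure (Cube p)) (ζ : Cube p → ℝ) (η : Cube p → Param d → ℝ)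
    (θ₀ : Param d) : Matrix (Fin d) (Fin d) ℝ :=
  Matrix.of fun j k =>
    ∫ t, (grad η θ₀ t j * grad η θ₀ t k - discrepancy ζ η θ₀ t * hess η θ₀ t j k) ∂F

/-- The matrix `A_n`, in which the empirical distribution replaces `F`. -/
def empHess {n : ℕ} (x : Fin n → Cube p) (ζ : Cube p → ℝ) (η : Cube p → Param d → ℝ)
    (θ₀ : Param d) : Matrix (Fin d) (Fin d) ℝ :=
  Matrix.of fun j k => (n : ℝ)⁻¹ *
    ∑ i, (grad η θ₀ (x i) j * grad η θ₀ (x i) k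
      - discrepancy ζ η θ₀ (x i) * hess η θ₀ (x i) j k)

/-- Convergence of the design. -/
structure DesignAssumption (F : Measure (Cube p)) (x : (n : ℕ) → Fin n → Cube p)
    (ζ : Cube p → ℝ) (η : Cube p → Param d → ℝ) (Θ : Set (Param d)) (θ₀ : Param d) : Prop where
  risk : TendstoUniformlyOn (fun n θ => empNorm (x n) (fun t => ζ t - η t θ) ^ 2)
    (popRisk F ζ η) atTop Θ
  hess : ∀ j k, Tendsto (fun n => empHess (x n) ζ η θ₀ j k) atTop (𝓝 (popHess F ζ η θ₀ j k))
  grad : (fun n : ℕ => ‖(n : ℝ)⁻¹ • ∑ i, discrepancy ζ η θ₀ (x n i) • grad η θ₀ (x n i)‖)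
    =O[atTop] fun n : ℕ => (n : ℝ) ^ (-(1 / 2) : ℝ)

/-- Assumptions on the discrepancy function `δ₀` and on its class `H` (finiteness of `J δ₀` is part
of the type of `J`). -/
structure DiscrepancyAssumption (x : (n : ℕ) → Fin n → Cube p) (H : Set (Cube p → ℝ))
    (J : (Cube p → ℝ) → ℝ) (δ₀ : Cube p → ℝ) (K₁ α : ℝ) : Prop where
  mem : δ₀ ∈ H
  bounded : ∃ B : ℝ, ∀ t, |δ₀ t| ≤ B
  entropy_le : ∀ u : ℝ, 0 < u → ∀ n, 1 ≤ n →
    entropy (x n) (normalizedClass H J δ₀) u ≤ ((K₁ * u ^ (-α) : ℝ) : EReal)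
  norm_le : ∃ R : ℝ, ∀ n, 1 ≤ n → ∀ γ ∈ normalizedClass H J δ₀, empNorm (x n) γ ≤ R

/-- The response `y_i = ζ(x_i) + ε_i`. -/
def response {Ω : Type*} (x : (n : ℕ) → Fin n → Cube p) (ζ : Cube p → ℝ)
    (ε : (n : ℕ) → Fin n → Ω → ℝ) (n : ℕ) (i : Fin n) (ω : Ω) : ℝ :=
  ζ (x n i) + ε n i ω

/-- `θhat` minimizes the least squares criterion over `Θ`. -/
def IsLeastSquares {n : ℕ} (x : Fin n → Cube p) (y : Fin n → ℝ) (η : Cube p → Param d → ℝ)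
    (Θ : Set (Param d)) (θhat : Param d) : Prop :=
  θhat ∈ Θ ∧ IsMinOn (fun θ => (n : ℝ)⁻¹ * ∑ i, (y i - η (x i) θ) ^ 2) Θ θhat

/-- `δhat` minimizes the penalized least squares criterion for the residuals over `H`. -/
def IsPenalizedLeastSquares {n : ℕ} (x : Fin n → Cube p) (y : Fin n → ℝ)
    (η : Cube p → Param d → ℝ) (θhat : Param d) (H : Set (Cube p → ℝ))
    (J : (Cube p → ℝ) → ℝ) (lam v : ℝ) (δhat : Cube p → ℝ) : Prop :=
  δhat ∈ H ∧ IsMinOn (fun δ => (n : ℝ)⁻¹ * ∑ i, (y i - η (x i) θhat - δ (x i)) ^ 2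
    + lam ^ 2 * J δ ^ v) H δhat

end Model

end Calibration

end

/-! Write X = ‖δhat - δ₀‖_n and j = J(δhat). Comparing δhat with δ₀ in the penalized criterion
bounds X² + λ² j^v by three terms: twice the empirical inner product of the errors with δhat - δ₀, a
term 2 ‖g_θhat - g_θ₀‖_n X from the first-step error, and λ² J(δ₀)^v.

Noise: by chaining (`exists_measure_modulus_le`), √n |⟨ε, γ⟩_n| ≤ C ‖γ‖_n^(1-α/2) holds
simultaneously on the normalized class with high probability. Multiplying by j + J(δ₀) turns this
into C n^(-1/2) X^(1-α/2) (j + J(δ₀))^(α/2) (`abs_empInner_sub_le`). Each function enters the chain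
at the scale of its own norm, so no separate peeling is needed.

First step: θhat is √n-consistent (`exists_eventually_measure_sqrt_mul_norm_sub_le`), so by the
Lipschitz condition the middle term is of order n^(-1/2) X. Consistency comes from a well-separated
minimum and a finite net of Θ. The rate comes from a Taylor expansion at θ₀: the curvature A is
positive definite, while the linear terms, bias and noise, are O_p(n^(-1/2)) times ‖θhat - θ₀‖.

What remains is a deterministic inequality between X, j, λ and n. Eliminating j leaves X raised to a
multiple of D = 2v - 2α + vα, and v > 2α/(2+α) says that D > 0 (`le_of_sq_add_penalty_le`). The two
rates follow by asking which term on the right dominates. -/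

namespace Calibration

open scoped NNReal ENNReal

/-! ### The empirical norm and inner product -/

section EmpiricalNorm

variable {X : Type*} {n : ℕ}

/-- The empirical inner product of a vector of errors and a function. -/
noncomputable def empInner (x : Fin n → X) (e : Fin n → ℝ) (f : X → ℝ) : ℝ :=
  (n : ℝ)⁻¹ * ∑ i, e i * f (x i)

lemma empNorm_nonneg (x : Fin n → X) (f : X → ℝ) : 0 ≤ empNorm x f := Real.sqrt_nonneg _

lemma empNorm_sq (x : Fin n → X) (f : X → ℝ) :
    empNorm x f ^ 2 = (n : ℝ)⁻¹ * ∑ i, f (x i) ^ 2 :=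
  Real.sq_sqrt (by positivity)

lemma empNorm_eq_norm (x : Fin n → X) (f : X → ℝ) :
    empNorm x f = √((n : ℝ)⁻¹) * ‖WithLp.toLp 2 (fun i => f (x i))‖ := by
  rw [empNorm, Real.sqrt_mul (by positivity), EuclideanSpace.norm_eq]
  simp

lemma empNorm_add_le (x : Fin n → X) (f g : X → ℝ) :
    empNorm x (fun t => f t + g t) ≤ empNorm x f + empNorm x g := by
  simp only [empNorm_eq_norm, ← mul_add]
  gcongr
  exact norm_add_le (WithLp.toLp 2 (fun i => f (x i))) (WithLp.toLp 2 (fun i => g (x i)))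

lemma empNorm_const_mul (x : Fin n → X) (c : ℝ) (f : X → ℝ) :
    empNorm x (fun t => c * f t) = |c| * empNorm x f := by
  simp only [empNorm_eq_norm]
  rw [show WithLp.toLp 2 (fun i => c * f (x i)) = c • WithLp.toLp 2 (fun i => f (x i)) from rfl,
    norm_smul, Real.norm_eq_abs]
  ring

lemma empNorm_sub_comm (x : Fin n → X) (f g : X → ℝ) :
    empNorm x (fun t => f t - g t) = empNorm x (fun t => g t - f t) := by
  rw [empNorm, empNorm]
  congr 2
  exact Finset.sum_congr rfl fun i _ => by ring

lemma empNorm_sub_le (x : Fin n → X) (f g h : X → ℝ) :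
    empNorm x (fun t => f t - h t)
      ≤ empNorm x (fun t => f t - g t) + empNorm x (fun t => g t - h t) := by
  refine le_trans (le_of_eq ?_)
    (empNorm_add_le x (fun t => f t - g t) (fun t => g t - h t))
  congr 1
  ext t
  ring

lemma empNorm_le_of_abs_le (x : Fin n → X) {f : X → ℝ} {B : ℝ} (hB : 0 ≤ B)
    (h : ∀ t, |f t| ≤ B) : empNorm x f ≤ B := by
  rw [empNorm]
  refine Real.sqrt_le_iff.2 ⟨hB, ?_⟩
  have h1 : ∑ i, f (x i) ^ 2 ≤ ∑ _i : Fin n, B ^ 2 :=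
    Finset.sum_le_sum fun i _ => sq_le_sq' (neg_le_of_abs_le (h _)) (le_of_abs_le (h _))
  rw [Finset.sum_const, Finset.card_univ, Fintype.card_fin, nsmul_eq_mul] at h1
  rcases Nat.eq_zero_or_pos n with rfl | hn
  · simpa using sq_nonneg B
  · have : (0 : ℝ) < n := by exact_mod_cast hn
    calc (n : ℝ)⁻¹ * ∑ i, f (x i) ^ 2 ≤ (n : ℝ)⁻¹ * (n * B ^ 2) := by gcongr
      _ = B ^ 2 := by field_simp

lemma empInner_add (x : Fin n → X) (e : Fin n → ℝ) (f g : X → ℝ) :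
    empInner x e (fun t => f t + g t) = empInner x e f + empInner x e g := by
  simp only [empInner, mul_add, Finset.sum_add_distrib]

lemma empInner_sub (x : Fin n → X) (e : Fin n → ℝ) (f g : X → ℝ) :
    empInner x e (fun t => f t - g t) = empInner x e f - empInner x e g := by
  simp only [empInner, mul_sub, Finset.sum_sub_distrib]

lemma empInner_const_mul (x : Fin n → X) (e : Fin n → ℝ) (c : ℝ) (f : X → ℝ) :
    empInner x e (fun t => c * f t) = c * empInner x e f := by
  simp only [empInner, Finset.mul_sum]
  exact Finset.sum_congr rfl fun i _ => by ring

/-- The Cauchy–Schwarz inequality. -/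
lemma abs_empInner_le (x : Fin n → X) (e : Fin n → ℝ) (f : X → ℝ) :
    |empInner x e f| ≤ √((n : ℝ)⁻¹ * ∑ i, e i ^ 2) * empNorm x f := by
  rw [empNorm, ← Real.sqrt_mul (by positivity)]
  apply Real.abs_le_sqrt
  have := Finset.sum_mul_sq_le_sq_mul_sq Finset.univ e (fun i => f (x i))
  rw [empInner, mul_pow]
  calc (n : ℝ)⁻¹ ^ 2 * (∑ i, e i * f (x i)) ^ 2
      ≤ (n : ℝ)⁻¹ ^ 2 * ((∑ i, e i ^ 2) * ∑ i, f (x i) ^ 2) := by gcongr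
    _ = _ := by ring

end EmpiricalNorm

/-! ### Sub-Gaussian errors -/

section SubGaussian

variable {Ω : Type*} [MeasurableSpace Ω] {P : Measure Ω}

/-- For a centred variable the linear term integrates to zero, so an exponential moment is bounded
by one of the square. On |u| ≤ 1 compare exp u with 1 + u + u²; outside, u² dominates |u|. -/
lemma exp_le_add_exp_sq (u : ℝ) : Real.exp u ≤ u + Real.exp (u ^ 2) := by
  have h2 : u ^ 2 + 1 ≤ Real.exp (u ^ 2) := Real.add_one_le_exp _
  rcases le_or_gt |u| 1 with h | h
  · have := (abs_le.1 (Real.abs_exp_sub_one_sub_id_le h)).2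
    linarith
  · rcases lt_abs.1 h with h | h
    · have : Real.exp u ≤ Real.exp (u ^ 2) := Real.exp_le_exp.2 (by nlinarith)
      linarith
    · have : Real.exp u ≤ 1 := Real.exp_le_one_iff.2 (by linarith)
      nlinarith

/-- Convexity of exp on the segment from 0 to u. With s = t²K² it reduces E exp(t²X²) to the assumed
moment E exp(X²/K²). -/
lemma exp_mul_le_one_add {s u : ℝ} (hs : 0 ≤ s) (hs1 : s ≤ 1) :
    Real.exp (s * u) ≤ 1 + s * (Real.exp u - 1) := by
  have := convexOn_exp.2 (Set.mem_univ (0 : ℝ)) (Set.mem_univ u) (by linarith : 0 ≤ 1 - s) hs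
    (by ring)
  simp only [smul_eq_mul, mul_zero, zero_add, Real.exp_zero] at this
  linarith

/-- A centred variable with `K² (E exp(X² / K²) - 1) ≤ σ₀²` has a sub-Gaussian moment generating
function. -/
lemma hasSubgaussianMGF_of_exp_sq [IsProbabilityMeasure P] {X : Ω → ℝ} {K σ₀ : ℝ}
    (hX : Measurable X) (hint : Integrable X P) (hmean : ∫ ω, X ω ∂P = 0) (hK : 0 < K)
    (hexp : Integrable (fun ω => Real.exp (X ω ^ 2 / K ^ 2)) P)
    (hle : K ^ 2 * ((∫ ω, Real.exp (X ω ^ 2 / K ^ 2) ∂P) - 1) ≤ σ₀ ^ 2) :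
    HasSubgaussianMGF X (K ^ 2 + 2 * σ₀ ^ 2).toNNReal P := by
  set m := ∫ ω, Real.exp (X ω ^ 2 / K ^ 2) ∂P with hm
  have hK2 : 0 < K ^ 2 := by positivity
  have hle' : m ≤ 1 + σ₀ ^ 2 / K ^ 2 := by
    have : m - 1 ≤ σ₀ ^ 2 / K ^ 2 := by rw [le_div_iff₀ hK2]; linarith
    linarith
  have hpt : ∀ t ω, Real.exp (t * X ω)
      ≤ Real.exp (t ^ 2 * K ^ 2 / 4) * Real.exp (X ω ^ 2 / K ^ 2) := by
    intro t ω
    rw [← Real.exp_add]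
    apply Real.exp_le_exp.2
    have : 0 ≤ (t * K / 2 - X ω / K) ^ 2 := sq_nonneg _
    have h3 : (t * K / 2 - X ω / K) ^ 2 = t ^ 2 * K ^ 2 / 4 + X ω ^ 2 / K ^ 2 - t * X ω := by
      field_simp
      ring
    linarith
  have hI : ∀ t : ℝ, Integrable (fun ω => Real.exp (t * X ω)) P := by
    intro t
    refine (hexp.const_mul (Real.exp (t ^ 2 * K ^ 2 / 4))).mono'
      (by fun_prop) (ae_of_all _ fun ω => ?_)
    rw [Real.norm_eq_abs, abs_of_pos (Real.exp_pos _)]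
    exact hpt t ω
  refine ⟨hI, fun t => ?_⟩
  rw [Real.coe_toNNReal _ (by positivity)]
  have hgoal : (K ^ 2 + 2 * σ₀ ^ 2) * t ^ 2 / 2 = t ^ 2 * K ^ 2 / 2 + t ^ 2 * σ₀ ^ 2 := by ring
  rw [hgoal, mgf]
  -- For small t the mean-zero property is essential. For large t the pointwise bound `hpt`
  -- (completing the square) suffices, since 1/K² < t² absorbs the moment m into exp(t²σ₀²).
  rcases le_or_gt (t ^ 2 * K ^ 2) 1 with ht | ht
  · have h1 : ∀ ω, Real.exp (t * X ω)
        ≤ t * X ω + (1 + t ^ 2 * K ^ 2 * (Real.exp (X ω ^ 2 / K ^ 2) - 1)) := by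
      intro ω
      refine (exp_le_add_exp_sq _).trans ?_
      have := exp_mul_le_one_add (u := X ω ^ 2 / K ^ 2) (by positivity) ht
      rw [show t ^ 2 * K ^ 2 * (X ω ^ 2 / K ^ 2) = (t * X ω) ^ 2 by field_simp] at this
      linarith
    have hi1 : Integrable (fun ω => t ^ 2 * K ^ 2 * (Real.exp (X ω ^ 2 / K ^ 2) - 1)) P :=
      (hexp.sub (integrable_const 1)).const_mul _
    have h2 : ∫ ω, Real.exp (t * X ω) ∂P ≤ 1 + t ^ 2 * K ^ 2 * (m - 1) := by
      refine (integral_mono (hI t) ((hint.const_mul t).add ((integrable_const 1).add hi1))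
        h1).trans (le_of_eq ?_)
      have hi2 : Integrable
          (fun ω => 1 + t ^ 2 * K ^ 2 * (Real.exp (X ω ^ 2 / K ^ 2) - 1)) P :=
        (integrable_const 1).add hi1
      simp only [Pi.add_apply]
      rw [integral_add (hint.const_mul t) hi2, integral_add (integrable_const 1) hi1,
        integral_const_mul, integral_const_mul,
        integral_sub hexp (integrable_const 1), hmean]
      simp [hm]
    refine h2.trans ?_
    have h3 : t ^ 2 * K ^ 2 * (m - 1) ≤ t ^ 2 * σ₀ ^ 2 := by
      rw [mul_assoc]
      gcongr
    have h4 := Real.add_one_le_exp (t ^ 2 * K ^ 2 / 2 + t ^ 2 * σ₀ ^ 2)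
    have h5 : 0 ≤ t ^ 2 * K ^ 2 / 2 := by positivity
    linarith
  · have h2 : ∫ ω, Real.exp (t * X ω) ∂P ≤ Real.exp (t ^ 2 * K ^ 2 / 4) * m := by
      refine (integral_mono (hI t) (hexp.const_mul _) (hpt t)).trans (le_of_eq ?_)
      rw [integral_const_mul]
    refine h2.trans ?_
    have h3 : m ≤ Real.exp (t ^ 2 * σ₀ ^ 2) := by
      refine hle'.trans ?_
      have h4 := Real.add_one_le_exp (t ^ 2 * σ₀ ^ 2)
      have h5 : σ₀ ^ 2 / K ^ 2 ≤ t ^ 2 * σ₀ ^ 2 := by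
        rw [div_le_iff₀ hK2]
        nlinarith [sq_nonneg σ₀]
      linarith
    calc Real.exp (t ^ 2 * K ^ 2 / 4) * m
        ≤ Real.exp (t ^ 2 * K ^ 2 / 2) * Real.exp (t ^ 2 * σ₀ ^ 2) := by
          gcongr
          · have : 0 ≤ t ^ 2 * K ^ 2 := by positivity
            linarith
      _ = _ := by rw [← Real.exp_add]

lemma ErrorAssumption.exists_hasSubgaussianMGF [IsProbabilityMeasure P]
    {ε : (n : ℕ) → Fin n → Ω → ℝ} (h : ErrorAssumption P ε) :
    ∃ c : ℝ≥0, 0 < c ∧ ∀ n i, HasSubgaussianMGF (ε n i) c P := by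
  obtain ⟨K, σ₀, hK, hs⟩ := h.subGaussian
  refine ⟨_, ?_, fun n i => hasSubgaussianMGF_of_exp_sq (h.measurable n i) (h.mean_zero n i).1
    (h.mean_zero n i).2 hK (hs n i).1 (hs n i).2⟩
  rw [Real.toNNReal_pos]
  positivity

/-- Tail bound for the empirical inner product of independent sub-Gaussian errors with a fixed
function. -/
lemma measure_abs_empInner_ge_le [IsProbabilityMeasure P] {X : Type*} {n : ℕ} {ε : Fin n → Ω → ℝ}
    (hind : iIndepFun ε P) {c : ℝ≥0} (hsub : ∀ i, HasSubgaussianMGF (ε i) c P)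
    (x : Fin n → X) (f : X → ℝ) {R a : ℝ} (hR : 0 < R) (hf : empNorm x f ≤ R) (ha : 0 ≤ a) :
    P {ω | a ≤ √n * |empInner x (fun i => ε i ω) f|}
      ≤ ENNReal.ofReal (2 * Real.exp (-a ^ 2 / (2 * c * R ^ 2))) := by
  -- For n = 0 the inner product vanishes: the event is empty unless a = 0, and then the bound is 2.
  rcases Nat.eq_zero_or_pos n with rfl | hn
  · rcases ha.eq_or_lt with rfl | ha
    · refine prob_le_one.trans ?_
      rw [← ENNReal.ofReal_one]
      apply ENNReal.ofReal_le_ofReal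
      simp
    · simp [ha.not_ge]
  have hn' : (0 : ℝ) < n := by exact_mod_cast hn
  set w : Fin n → ℝ := fun i => √n * (n : ℝ)⁻¹ * f (x i) with hw
  set v : ℝ≥0 := ∑ i, NNReal.mk (w i ^ 2) (sq_nonneg _) * c with hv
  have hsubG : HasSubgaussianMGF (fun ω => ∑ i, w i * ε i ω) v P := by
    refine HasSubgaussianMGF.sum_of_iIndepFun
      (X := fun i ω => w i * ε i ω) ?_ (fun i _ => (hsub i).const_mul (w i))
    exact hind.comp (fun i y => w i * y) (fun i => by fun_prop)
  have hvR : (v : ℝ) ≤ c * R ^ 2 := by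
    have h1 : (v : ℝ) = c * empNorm x f ^ 2 := by
      rw [empNorm_sq, hv, NNReal.coe_sum, Finset.mul_sum, Finset.mul_sum]
      refine Finset.sum_congr rfl fun i _ => ?_
      rw [NNReal.coe_mul, NNReal.coe_mk, hw]
      simp only [mul_pow]
      rw [Real.sq_sqrt hn'.le]
      field_simp
    rw [h1]
    gcongr
    exact empNorm_nonneg _ _
  have hsum : ∀ ω, √n * empInner x (fun i => ε i ω) f = ∑ i, w i * ε i ω := by
    intro ω
    rw [empInner, ← mul_assoc, Finset.mul_sum]
    exact Finset.sum_congr rfl fun i _ => by rw [hw]; ring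
  -- Enlarging the variance proxy c‖f‖_n² to cR² makes the tail depend on f only through R.
  have hv0 : HasSubgaussianMGF (fun ω => ∑ i, w i * ε i ω) (c * R ^ 2).toNNReal P := by
    refine ⟨hsubG.1, fun t => (hsubG.2 t).trans ?_⟩
    apply Real.exp_le_exp.2
    rw [Real.coe_toNNReal _ (by positivity)]
    gcongr
  have key : ∀ Y : Ω → ℝ, HasSubgaussianMGF Y (c * R ^ 2).toNNReal P →
      P {ω | a ≤ Y ω} ≤ ENNReal.ofReal (Real.exp (-a ^ 2 / (2 * c * R ^ 2))) := by
    intro Y hY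
    have := hY.measure_ge_le ha
    rw [Real.coe_toNNReal _ (by positivity), ← mul_assoc] at this
    rw [← ofReal_measureReal]
    exact ENNReal.ofReal_le_ofReal this
  have hsubset : {ω | a ≤ √n * |empInner x (fun i => ε i ω) f|}
      ⊆ {ω | a ≤ ∑ i, w i * ε i ω} ∪ {ω | a ≤ (-fun ω => ∑ i, w i * ε i ω) ω} := by
    intro ω hω
    have h1 : a ≤ |∑ i, w i * ε i ω| := by
      rw [← hsum, abs_mul, abs_of_nonneg (Real.sqrt_nonneg _)]
      exact hω
    exact le_abs.1 h1
  refine (measure_mono hsubset).trans ((measure_union_le _ _).trans ?_)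
  refine (add_le_add (key _ hv0) (key _ hv0.neg)).trans (le_of_eq ?_)
  rw [← ENNReal.ofReal_add (by positivity) (by positivity), ← two_mul]

end SubGaussian

/-! ### Chaining and the modulus of continuity -/

section Chaining

variable {X : Type*} {n : ℕ}

/-- A real bound on the entropy excludes the value ⊤, and an infimum over a nonempty subset of `ℕ∞`
is attained, so an optimal finite net exists. -/
lemma exists_net_of_entropy_le {x : Fin n → X} {G : Set (X → ℝ)} {u r : ℝ}
    (h : entropy x G u ≤ (r : EReal)) :
    ∃ m : ℕ, (m : ℝ) ≤ Real.exp r ∧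
      ∃ c : Fin m → X → ℝ, ∀ γ ∈ G, ∃ j, empNorm x (fun t => γ t - c j t) ≤ u := by
  rw [entropy, ← Real.log_exp r, ← ENNReal.log_ofReal_of_pos (Real.exp_pos r),
    ENNReal.log_le_log_iff] at h
  have hne : coveringNumber x G u ≠ ⊤ := by
    intro htop
    rw [htop] at h
    simp at h
  have hnonempty : {N : ℕ∞ | ∃ m : ℕ, N = m ∧
      ∃ c : Fin m → X → ℝ, ∀ γ ∈ G, ∃ j, empNorm x (fun t => γ t - c j t) ≤ u}.Nonempty := by
    rw [Set.nonempty_iff_ne_empty]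
    intro hempty
    exact hne (by rw [coveringNumber, hempty, sInf_empty])
  obtain ⟨m, hm, c, hc⟩ := csInf_mem hnonempty
  refine ⟨m, ?_, c, hc⟩
  rw [coveringNumber, hm, ENat.toENNReal_coe, ENNReal.le_ofReal_iff_toReal_le (by simp)
    (Real.exp_pos r).le] at h
  simpa using h

/-- The constant lost in summing a chain of links at geometric scales with exponent `β`. -/
noncomputable def chainConst (β : ℝ) : ℝ := 2 ^ β * (1 + (1 - (1 / 2 : ℝ) ^ β)⁻¹)

lemma half_rpow_lt_one {β : ℝ} (hβ : 0 < β) : (1 / 2 : ℝ) ^ β < 1 :=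
  Real.rpow_lt_one (by norm_num) (by norm_num) hβ

lemma chainConst_pos {β : ℝ} (hβ : 0 < β) : 0 < chainConst β := by
  have : 0 < 1 - (1 / 2 : ℝ) ^ β := sub_pos.2 (half_rpow_lt_one hβ)
  unfold chainConst
  positivity

/-- Deterministic chaining: bounds on the links of nets at the scales `R * 2⁻ᵏ` give a bound for
the empirical inner product on the whole class, in terms of the norm. -/
lemma abs_empInner_le_of_nets (x : Fin n → X) (e : Fin n → ℝ) {G : Set (X → ℝ)} {R C β : ℝ}
    (hR : 0 < R) (hC : 0 ≤ C) (hβ : 0 < β) {m : ℕ → ℕ} (c : (k : ℕ) → Fin (m k) → X → ℝ)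
    (hnet : ∀ k, ∀ γ ∈ G, ∃ j, empNorm x (fun t => γ t - c k j t) ≤ R * (1 / 2) ^ k)
    (hG : ∀ γ ∈ G, empNorm x γ ≤ R)
    (hstart : ∀ k j, empNorm x (c k j) ≤ 2 * (R * (1 / 2) ^ k) →
      √n * |empInner x e (c k j)| ≤ C * (R * (1 / 2) ^ k) ^ β)
    (hlink : ∀ k j j', empNorm x (fun t => c (k + 1) j' t - c k j t) ≤ 2 * (R * (1 / 2) ^ k) →
      √n * |empInner x e (fun t => c (k + 1) j' t - c k j t)| ≤ C * (R * (1 / 2) ^ k) ^ β) :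
    ∀ γ ∈ G, √n * |empInner x e γ| ≤ C * chainConst β * empNorm x γ ^ β := by
  intro γ hγ
  -- Crude Cauchy–Schwarz constant for the fixed error vector. It is only used for the remainder
  -- beyond the K-th link, which vanishes as K → ∞.
  set L : ℝ := √n * √((n : ℝ)⁻¹ * ∑ i, e i ^ 2) with hL
  have hlip : ∀ f, √n * |empInner x e f| ≤ L * empNorm x f := fun f => by
    rw [hL, mul_assoc]
    exact mul_le_mul_of_nonneg_left (abs_empInner_le x e f) (Real.sqrt_nonneg _)
  rcases (empNorm_nonneg x γ).eq_or_lt with h0 | hpos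
  · have := hlip γ
    rw [← h0, Real.zero_rpow hβ.ne']
    rw [← h0] at this
    linarith
  -- The chain starts at the dyadic scale just above ‖γ‖_n, namely R 2^(-s-1) < ‖γ‖_n ≤ R 2^(-s);
  -- this is what produces the factor ‖γ‖_n^β.
  obtain ⟨s, hs1, hs2⟩ := exists_nat_pow_near_of_lt_one (x := empNorm x γ / R) (y := (1 / 2 : ℝ))
    (by positivity) ((div_le_one hR).2 (hG γ hγ)) (by norm_num) (by norm_num)
  rw [div_le_iff₀ hR, mul_comm] at hs2
  rw [lt_div_iff₀ hR, mul_comm] at hs1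
  choose π hπ using fun k => hnet k γ hγ
  set u : ℕ → ℝ := fun k => R * (1 / 2) ^ k with hu
  have hupos : ∀ k, 0 < u k := fun k => by positivity
  set q : ℝ := (1 / 2 : ℝ) ^ β with hq
  have hq0 : 0 ≤ q := by positivity
  have hq1 : q < 1 := half_rpow_lt_one hβ
  have huq : ∀ K, u (s + K) ^ β = u s ^ β * q ^ K := by
    intro K
    have h1 : u (s + K) = u s * (1 / 2) ^ K := by simp only [hu]; ring
    rw [h1, Real.mul_rpow (hupos s).le (by positivity), hq, ← Real.rpow_natCast, ← Real.rpow_mul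
      (by norm_num), ← Real.rpow_natCast, ← Real.rpow_mul (by norm_num), mul_comm β]
  have hchain : ∀ K, √n * |empInner x e (c (s + K) (π (s + K)))|
      ≤ C * u s ^ β * (1 + ∑ i ∈ Finset.range K, q ^ i) := by
    intro K
    induction K with
    | zero =>
      simp only [Finset.range_zero, Finset.sum_empty, add_zero, mul_one]
      have h1 := empNorm_sub_le x (c s (π s)) γ (fun _ => 0)
      simp only [sub_zero] at h1
      rw [empNorm_sub_comm] at h1
      change empNorm x (c s (π s)) ≤ _ + empNorm x γ at h1
      exact hstart s (π s) (by linarith [hπ s])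
    | succ K ih =>
      have h1 : empNorm x (fun t => c (s + K + 1) (π (s + K + 1)) t - c (s + K) (π (s + K)) t)
          ≤ 2 * (R * (1 / 2) ^ (s + K)) := by
        refine (empNorm_sub_le x _ γ _).trans ?_
        rw [empNorm_sub_comm x _ γ]
        have h2 := hπ (s + K + 1)
        have h3 := hπ (s + K)
        rw [pow_succ] at h2
        have h4 := hupos (s + K)
        simp only [hu] at h4
        linarith
      have h2 := hlink _ _ _ h1
      rw [empInner_sub] at h2
      have h3 : |empInner x e (c (s + K + 1) (π (s + K + 1)))|
          ≤ |empInner x e (c (s + K + 1) (π (s + K + 1))) - empInner x e (c (s + K) (π (s + K)))|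
            + |empInner x e (c (s + K) (π (s + K)))| := by
        refine le_trans (le_of_eq ?_) (abs_add_le _ _)
        congr 1
        ring
      have h4 : C * (R * (1 / 2) ^ (s + K)) ^ β = C * (u s ^ β * q ^ K) := by rw [← huq K]
      rw [h4] at h2
      have h5 := mul_le_mul_of_nonneg_left h3 (Real.sqrt_nonneg n)
      rw [← add_assoc, Finset.sum_range_succ]
      linarith
  have hgeom : ∀ K, ∑ i ∈ Finset.range K, q ^ i ≤ (1 - q)⁻¹ := by
    intro K
    rw [← tsum_geometric_of_lt_one hq0 hq1]
    exact (summable_geometric_of_lt_one hq0 hq1).sum_le_tsum _ (fun i _ => by positivity)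
  have hbound : ∀ K, √n * |empInner x e γ|
      ≤ L * (u s * (1 / 2) ^ K) + C * u s ^ β * (1 + (1 - q)⁻¹) := by
    intro K
    have h1 := (hlip (fun t => γ t - c (s + K) (π (s + K)) t)).trans
      (mul_le_mul_of_nonneg_left (hπ (s + K)) (by positivity))
    rw [empInner_sub] at h1
    have h2 : |empInner x e γ| ≤ |empInner x e γ - empInner x e (c (s + K) (π (s + K)))|
        + |empInner x e (c (s + K) (π (s + K)))| := by
      refine le_trans (le_of_eq ?_) (abs_add_le _ _)
      congr 1
      ring
    have h3 := mul_le_mul_of_nonneg_left h2 (Real.sqrt_nonneg n)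
    have h4 : C * u s ^ β * (1 + ∑ i ∈ Finset.range K, q ^ i)
        ≤ C * u s ^ β * (1 + (1 - q)⁻¹) := by
      gcongr
      exact hgeom K
    have h5 : R * (1 / 2) ^ (s + K) = u s * (1 / 2) ^ K := by simp only [hu]; ring
    rw [h5] at h1
    linarith [hchain K]
  have hlim : √n * |empInner x e γ| ≤ L * (u s * 0) + C * u s ^ β * (1 + (1 - q)⁻¹) := by
    have h0 : Tendsto (fun K : ℕ => (1 / 2 : ℝ) ^ K) atTop (𝓝 0) :=
      tendsto_pow_atTop_nhds_zero_of_lt_one (by norm_num) (by norm_num)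
    exact ge_of_tendsto' (((h0.const_mul _).const_mul _).add_const _) hbound
  rw [mul_zero, mul_zero, zero_add] at hlim
  refine hlim.trans ?_
  have h1 : u s ≤ 2 * empNorm x γ := by
    rw [pow_succ] at hs1
    simp only [hu]
    linarith
  have h2 : u s ^ β ≤ 2 ^ β * empNorm x γ ^ β := by
    rw [← Real.mul_rpow (by norm_num) hpos.le]
    exact Real.rpow_le_rpow (hupos s).le h1 hβ.le
  have hq' : 0 < 1 - q := sub_pos.2 hq1
  calc C * u s ^ β * (1 + (1 - q)⁻¹) ≤ C * (2 ^ β * empNorm x γ ^ β) * (1 + (1 - q)⁻¹) := by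
        gcongr
    _ = _ := by rw [chainConst]; ring

variable {Ω : Type*} [MeasurableSpace Ω] {P : Measure Ω}

/-- The failure probability of the links between two consecutive nets. -/
lemma measure_link_fail_le [IsProbabilityMeasure P] {ε : Fin n → Ω → ℝ}
    (hind : iIndepFun ε P) {σ : ℝ≥0} (hsub : ∀ i, HasSubgaussianMGF (ε i) σ P) (hσ : 0 < σ)
    (x : Fin n → X) {K₁ α B u C : ℝ} (hK₁ : 0 < K₁) (hB : 0 < B) (hu : 0 < u)
    (hC : C = √(8 * σ * ((1 + 2 ^ α) * K₁ + B)))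
    {m m' : ℕ} (c : Fin m → X → ℝ) (c' : Fin m' → X → ℝ)
    (hm : (m : ℝ) ≤ Real.exp (K₁ * u ^ (-α))) (hm' : (m' : ℝ) ≤ Real.exp (K₁ * (u / 2) ^ (-α))) :
    P {ω | (∃ j, empNorm x (c j) ≤ 2 * u ∧
          C * u ^ (1 - α / 2) < √n * |empInner x (fun i => ε i ω) (c j)|) ∨
        ∃ j j', empNorm x (fun t => c' j' t - c j t) ≤ 2 * u ∧
          C * u ^ (1 - α / 2) < √n * |empInner x (fun i => ε i ω) (fun t => c' j' t - c j t)|}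
      ≤ ENNReal.ofReal (4 * u ^ α / B) := by
  have hσ' : (0 : ℝ) < σ := hσ
  set p : ℝ := 2 * Real.exp (-(C * u ^ (1 - α / 2)) ^ 2 / (2 * σ * (2 * u) ^ 2)) with hp
  have hp0 : 0 ≤ p := by positivity
  have hC0 : 0 ≤ C := hC ▸ Real.sqrt_nonneg _
  -- The norm condition does not involve ω, so the event is empty when it fails.
  have hsingle : ∀ f : X → ℝ, P {ω | empNorm x f ≤ 2 * u ∧
      C * u ^ (1 - α / 2) < √n * |empInner x (fun i => ε i ω) f|} ≤ ENNReal.ofReal p := by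
    intro f
    by_cases hf : empNorm x f ≤ 2 * u
    · refine (measure_mono ?_).trans
        (measure_abs_empInner_ge_le hind hsub x f (by positivity) hf (by positivity))
      exact fun ω hω => hω.2.le
    · simp [hf]
  have hunion : P {ω | (∃ j, empNorm x (c j) ≤ 2 * u ∧
          C * u ^ (1 - α / 2) < √n * |empInner x (fun i => ε i ω) (c j)|) ∨
        ∃ j j', empNorm x (fun t => c' j' t - c j t) ≤ 2 * u ∧
          C * u ^ (1 - α / 2) < √n * |empInner x (fun i => ε i ω) (fun t => c' j' t - c j t)|}
      ≤ ENNReal.ofReal ((m + m * m') * p) := by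
    rw [Set.ofPred_or]
    refine (measure_union_le _ _).trans ?_
    rw [add_mul, ENNReal.ofReal_add (by positivity) (by positivity)]
    refine add_le_add ?_ ?_
    · rw [Set.ofPred_exists]
      refine (measure_iUnion_fintype_le _ _).trans ?_
      refine (Finset.sum_le_sum fun j _ => hsingle (c j)).trans (le_of_eq ?_)
      rw [Finset.sum_const, Finset.card_univ, Fintype.card_fin, nsmul_eq_mul,
        ENNReal.ofReal_mul (Nat.cast_nonneg m), ENNReal.ofReal_natCast]
    · simp only [Set.ofPred_exists]
      refine (measure_iUnion_fintype_le _ _).trans ?_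
      refine (Finset.sum_le_sum fun j _ => (measure_iUnion_fintype_le _ _).trans
        (Finset.sum_le_sum fun j' _ => hsingle (fun t => c' j' t - c j t))).trans (le_of_eq ?_)
      rw [Finset.sum_const, Finset.sum_const, Finset.card_univ, Fintype.card_fin, Finset.card_univ,
        Fintype.card_fin, nsmul_eq_mul, nsmul_eq_mul, mul_assoc (m : ℝ),
        ENNReal.ofReal_mul (Nat.cast_nonneg m), ENNReal.ofReal_mul (Nat.cast_nonneg m'),
        ENNReal.ofReal_natCast, ENNReal.ofReal_natCast]
  refine hunion.trans (ENNReal.ofReal_le_ofReal ?_)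
  set w : ℝ := u ^ (-α) with hw
  have hwpos : 0 < w := by positivity
  have hhalf : (u / 2) ^ (-α) = 2 ^ α * w := by
    rw [Real.div_rpow hu.le (by norm_num), Real.rpow_neg (by norm_num : (0 : ℝ) ≤ 2), hw]
    field_simp
  -- C is chosen for this exponent: the part (1 + 2^α) K₁ pays for the number of pairs of net
  -- points, and B is left over as decay.
  have hexpo : -(C * u ^ (1 - α / 2)) ^ 2 / (2 * σ * (2 * u) ^ 2)
      = -((1 + 2 ^ α) * K₁ + B) * w := by
    have h1 : (u ^ (1 - α / 2)) ^ 2 = u ^ 2 * w := by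
      rw [hw, ← Real.rpow_natCast, ← Real.rpow_mul hu.le, ← Real.rpow_natCast u 2,
        ← Real.rpow_add hu]
      congr 1
      push_cast
      ring
    have h2 : C ^ 2 = 8 * σ * ((1 + 2 ^ α) * K₁ + B) := by
      rw [hC, Real.sq_sqrt (by positivity)]
    rw [mul_pow, h1, h2]
    field_simp
    ring
  rw [hhalf] at hm'
  have hone : 1 ≤ Real.exp (K₁ * (2 ^ α * w)) := Real.one_le_exp (by positivity)
  have hcount : (m + m * m' : ℝ) ≤ 2 * Real.exp ((1 + 2 ^ α) * K₁ * w) := by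
    have h1 : Real.exp ((1 + 2 ^ α) * K₁ * w)
        = Real.exp (K₁ * w) * Real.exp (K₁ * (2 ^ α * w)) := by
      rw [← Real.exp_add]
      congr 1
      ring
    calc (m + m * m' : ℝ) = m * (1 + m') := by ring
      _ ≤ Real.exp (K₁ * w) * (Real.exp (K₁ * (2 ^ α * w)) + Real.exp (K₁ * (2 ^ α * w))) := by
        gcongr
      _ = _ := by rw [h1]; ring
  -- The weak bound exp(-y) ≤ 1/y is enough, because u^α is already summable over dyadic scales.
  have hdecay : Real.exp (-(B * w)) ≤ u ^ α / B := by
    have h1 : B * w ≤ Real.exp (B * w) := by linarith [Real.add_one_le_exp (B * w)]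
    have h2 : u ^ α / B = (B * w)⁻¹ := by
      rw [hw, Real.rpow_neg hu.le]
      field_simp
    rw [Real.exp_neg, h2]
    exact inv_anti₀ (by positivity) h1
  calc (m + m * m' : ℝ) * p
      ≤ 2 * Real.exp ((1 + 2 ^ α) * K₁ * w) * p := by gcongr
    _ = 4 * Real.exp (-(B * w)) := by
        rw [hp, hexpo]
        rw [show 2 * Real.exp ((1 + 2 ^ α) * K₁ * w)
            * (2 * Real.exp (-((1 + 2 ^ α) * K₁ + B) * w))
          = 4 * (Real.exp ((1 + 2 ^ α) * K₁ * w) * Real.exp (-((1 + 2 ^ α) * K₁ + B) * w)) by ring,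
          ← Real.exp_add]
        congr 2
        ring
    _ ≤ 4 * (u ^ α / B) := by gcongr
    _ = _ := by ring

/-- The modulus of continuity of the empirical process of sub-Gaussian errors, indexed by a class
with polynomial entropy. -/
lemma exists_measure_modulus_le [IsProbabilityMeasure P] {ε : (n : ℕ) → Fin n → Ω → ℝ}
    (hind : ∀ n, iIndepFun (ε n) P) {σ : ℝ≥0} (hsub : ∀ n i, HasSubgaussianMGF (ε n i) σ P)
    (hσ : 0 < σ) {K₁ α R : ℝ} (hK₁ : 0 < K₁) (hα₀ : 0 < α) (hα₂ : α < 2) (hR : 0 < R)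
    {e : ℝ} (he : 0 < e) :
    ∃ C : ℝ, 0 < C ∧ ∀ (n : ℕ) (x : Fin n → X) (G : Set (X → ℝ)),
      (∀ u : ℝ, 0 < u → entropy x G u ≤ ((K₁ * u ^ (-α) : ℝ) : EReal)) →
      (∀ γ ∈ G, empNorm x γ ≤ R) →
      P {ω | ∃ γ ∈ G, C * empNorm x γ ^ (1 - α / 2) < √n * |empInner x (fun i => ε n i ω) γ|}
        ≤ ENNReal.ofReal e := by
  have hσ' : (0 : ℝ) < σ := hσ
  set q : ℝ := (1 / 2 : ℝ) ^ α with hq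
  have hq0 : 0 ≤ q := by positivity
  have hq1 : q < 1 := half_rpow_lt_one hα₀
  have hq1' : 0 < 1 - q := sub_pos.2 hq1
  -- Makes the geometric series of failure probabilities 4 (R 2^(-k))^α / B sum to exactly e.
  set B : ℝ := 4 * R ^ α * (1 - q)⁻¹ / e with hBdef
  have hB : 0 < B := by positivity
  set C : ℝ := √(8 * σ * ((1 + 2 ^ α) * K₁ + B)) with hC
  have hC0 : 0 < C := Real.sqrt_pos.2 (by positivity)
  have hβ : 0 < 1 - α / 2 := by linarith
  refine ⟨C * chainConst (1 - α / 2), mul_pos hC0 (chainConst_pos hβ), ?_⟩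
  intro n x G hent hGR
  have hupos : ∀ k : ℕ, 0 < R * (1 / 2) ^ k := fun k => by positivity
  choose m hm c hc using fun k : ℕ => exists_net_of_entropy_le (hent _ (hupos k))
  have hlevel := fun k => measure_link_fail_le (hind n) (hsub n) hσ x hK₁ hB (hupos k) hC (c k)
    (c (k + 1)) (hm k) (by
      refine (hm (k + 1)).trans (le_of_eq ?_)
      rw [show R * (1 / 2) ^ (k + 1) = R * (1 / 2) ^ k / 2 by ring])
  refine (measure_mono ?_).trans ((measure_iUnion_le _).trans
    ((ENNReal.tsum_le_tsum hlevel).trans (le_of_eq ?_)))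
  · rintro ω ⟨γ, hγ, hlt⟩
    by_contra hnot
    simp only [Set.mem_iUnion, Set.mem_ofPred_eq, not_exists, not_or, not_and, not_lt] at hnot
    exact absurd hlt (not_lt.2 (abs_empInner_le_of_nets x (fun i => ε n i ω) hR hC0.le hβ c hc hGR
      (fun k j => (hnot k).1 j) (fun k j j' => (hnot k).2 j j') γ hγ))
  · have hterm : ∀ k : ℕ, 4 * (R * (1 / 2) ^ k) ^ α / B = 4 * R ^ α / B * q ^ k := by
      intro k
      rw [Real.mul_rpow hR.le (by positivity), hq, ← Real.rpow_natCast, ← Real.rpow_natCast,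
        ← Real.rpow_mul (by norm_num), ← Real.rpow_mul (by norm_num), mul_comm α]
      ring
    simp_rw [hterm]
    rw [← ENNReal.ofReal_tsum_of_nonneg (fun k => by positivity)
      ((summable_geometric_of_lt_one hq0 hq1).mul_left _), tsum_mul_left,
      tsum_geometric_of_lt_one hq0 hq1]
    congr 1
    rw [hBdef]
    field_simp

end Chaining

/-! ### Bounds in probability for the noise -/

section Noise

variable {Ω : Type*} [MeasurableSpace Ω] {P : Measure Ω} {ε : (n : ℕ) → Fin n → Ω → ℝ}

/-- Monotonicity and subadditivity hold for outer measure, so no measurability of the estimators is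
required. -/
lemma measure_le_add_of_ae_imp {p q r : Ω → Prop} (h : ∀ᵐ ω ∂P, p ω → q ω ∨ r ω) :
    P {ω | p ω} ≤ P {ω | q ω} + P {ω | r ω} :=
  (measure_mono_ae (s := {ω | p ω}) (t := {ω | q ω} ∪ {ω | r ω}) h).trans (measure_union_le _ _)

/-- The empirical norm of the errors is bounded in probability. -/
lemma ErrorAssumption.exists_measure_sqrt_le [IsProbabilityMeasure P] (h : ErrorAssumption P ε)
    {e : ℝ} (he : 0 < e) :
    ∃ T : ℝ, 0 < T ∧ ∀ n : ℕ, P {ω | T < √((n : ℝ)⁻¹ * ∑ i, ε n i ω ^ 2)} ≤ ENNReal.ofReal e := by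
  obtain ⟨σ, hσ⟩ := h.variance
  -- Markov's inequality for the mean square; the added 1 keeps T positive when σ = 0.
  set T : ℝ := √((σ ^ 2 + 1) / e) with hT
  have hTpos : 0 < T := Real.sqrt_pos.2 (by positivity)
  refine ⟨T, hTpos, fun n => ?_⟩
  set f : Ω → ℝ := fun ω => (n : ℝ)⁻¹ * ∑ i, ε n i ω ^ 2 with hf
  have hint : Integrable f P :=
    (integrable_finsetSum _ fun i _ => (hσ n i).1).const_mul _
  have hval : ∫ ω, f ω ∂P ≤ σ ^ 2 := by
    rw [hf, integral_const_mul, integral_finsetSum _ fun i _ => (hσ n i).1]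
    simp_rw [(hσ n _).2]
    rw [Finset.sum_const, Finset.card_univ, Fintype.card_fin, nsmul_eq_mul, ← mul_assoc]
    exact mul_le_of_le_one_left (sq_nonneg σ) (inv_mul_le_one (a := (n : ℝ)))
  have hmarkov := mul_meas_ge_le_integral_of_nonneg (μ := P) (f := f)
    (ae_of_all _ fun ω => by positivity) hint (T ^ 2)
  have hsub : {ω | T < √((n : ℝ)⁻¹ * ∑ i, ε n i ω ^ 2)} ⊆ {ω | T ^ 2 ≤ f ω} := fun ω hω =>
    (Real.lt_sqrt hTpos.le).1 hω |>.le
  refine (measure_mono hsub).trans ?_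
  rw [← ofReal_measureReal]
  apply ENNReal.ofReal_le_ofReal
  have hT2 : T ^ 2 = (σ ^ 2 + 1) / e := Real.sq_sqrt (by positivity)
  have h1 : T ^ 2 * P.real {ω | T ^ 2 ≤ f ω} ≤ T ^ 2 * e := by
    refine hmarkov.trans (hval.trans ?_)
    rw [hT2, div_mul_cancel₀ _ he.ne']
    linarith
  exact le_of_mul_le_mul_left h1 (by positivity)

lemma exists_measure_empInner_le [IsProbabilityMeasure P] {X : Type*}
    (hind : ∀ n, iIndepFun (ε n) P) {σ : ℝ≥0} (hsub : ∀ n i, HasSubgaussianMGF (ε n i) σ P)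
    (hσ : 0 < σ) {R : ℝ} (hR : 0 < R) {e : ℝ} (he : 0 < e) :
    ∃ C : ℝ, 0 < C ∧ ∀ (n : ℕ) (x : Fin n → X) (f : X → ℝ), empNorm x f ≤ R →
      P {ω | C < √n * |empInner x (fun i => ε n i ω) f|} ≤ ENNReal.ofReal e := by
  have hσ' : (0 : ℝ) < σ := hσ
  -- Turns the tail into 2 exp(-2/e), which is at most e.
  set C : ℝ := √(4 * σ * R ^ 2 / e) with hC
  have hCpos : 0 < C := Real.sqrt_pos.2 (by positivity)
  refine ⟨C, hCpos, fun n x f hf => ?_⟩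
  refine (measure_mono fun ω hω => ?_).trans ((measure_abs_empInner_ge_le (hind n) (hsub n) x f hR
    hf hCpos.le).trans (ENNReal.ofReal_le_ofReal ?_))
  · exact (show C < _ from hω).le
  · have hC2 : C ^ 2 = 4 * σ * R ^ 2 / e := Real.sq_sqrt (by positivity)
    have h1 : -C ^ 2 / (2 * σ * R ^ 2) = -(2 / e) := by
      rw [hC2]
      field_simp
      ring
    have h2 : 2 / e ≤ Real.exp (2 / e) := by linarith [Real.add_one_le_exp (2 / e)]
    rw [h1, Real.exp_neg]
    have h3 : (Real.exp (2 / e))⁻¹ ≤ (2 / e)⁻¹ := inv_anti₀ (by positivity) h2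
    calc 2 * (Real.exp (2 / e))⁻¹ ≤ 2 * (2 / e)⁻¹ := by gcongr
      _ = e := by field_simp

lemma exists_measure_exists_empInner_le [IsProbabilityMeasure P] {X : Type*}
    (hind : ∀ n, iIndepFun (ε n) P) {σ : ℝ≥0} (hsub : ∀ n i, HasSubgaussianMGF (ε n i) σ P)
    (hσ : 0 < σ) {ι : Type*} [Fintype ι] {R : ℝ} (hR : 0 < R) {e : ℝ} (he : 0 < e) :
    ∃ C : ℝ, 0 < C ∧ ∀ (n : ℕ) (x : Fin n → X) (f : ι → X → ℝ), (∀ j, empNorm x (f j) ≤ R) →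
      P {ω | ∃ j, C < √n * |empInner x (fun i => ε n i ω) (f j)|} ≤ ENNReal.ofReal e := by
  obtain ⟨C, hC, h⟩ := exists_measure_empInner_le (X := X) hind hsub hσ hR
    -- Union bound; the added 1 avoids a division by zero when ι is empty.
    (e := e / (Fintype.card ι + 1)) (by positivity)
  refine ⟨C, hC, fun n x f hf => ?_⟩
  rw [Set.ofPred_exists]
  refine (measure_iUnion_fintype_le _ _).trans ((Finset.sum_le_sum fun j _ => h n x (f j)
    (hf j)).trans ?_)
  rw [Finset.sum_const, Finset.card_univ, nsmul_eq_mul, ← ENNReal.ofReal_natCast,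
    ← ENNReal.ofReal_mul (by positivity)]
  apply ENNReal.ofReal_le_ofReal
  rw [mul_div_assoc', div_le_iff₀ (by positivity)]
  nlinarith

end Noise

/-! ### Consistency of the least squares estimator -/

section Consistency

variable {p d : ℕ}

/-- The basic inequality of least squares. -/
lemma IsLeastSquares.basic_inequality {n : ℕ} {x : Fin n → Cube p} {ζ : Cube p → ℝ}
    {e : Fin n → ℝ} {η : Cube p → Param d → ℝ} {Θ : Set (Param d)} {θhat θ₀ : Param d}
    (h : IsLeastSquares x (fun i => ζ (x i) + e i) η Θ θhat) (hθ₀ : θ₀ ∈ Θ) :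
    empNorm x (fun t => ζ t - η t θhat) ^ 2 - empNorm x (fun t => ζ t - η t θ₀) ^ 2
      ≤ 2 * empInner x e (fun t => η t θhat - η t θ₀) := by
  have h1 := h.2 hθ₀
  simp only [Set.mem_ofPred_eq] at h1
  have h2 : ∀ θ, (n : ℝ)⁻¹ * ∑ i, (ζ (x i) + e i - η (x i) θ) ^ 2
      = empNorm x (fun t => ζ t - η t θ) ^ 2
        + 2 * empInner x e (fun t => ζ t - η t θ) + (n : ℝ)⁻¹ * ∑ i, e i ^ 2 := by
    intro θ
    rw [empNorm_sq, empInner, mul_left_comm, ← mul_add, ← mul_add]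
    congr 1
    rw [Finset.mul_sum, ← Finset.sum_add_distrib, ← Finset.sum_add_distrib]
    exact Finset.sum_congr rfl fun i _ => by ring
  rw [h2, h2, empInner_sub, empInner_sub] at h1
  rw [empInner_sub]
  linarith

lemma popRisk_nonneg (F : Measure (Cube p)) (ζ : Cube p → ℝ) (η : Cube p → Param d → ℝ)
    (θ : Param d) : 0 ≤ popRisk F ζ η θ :=
  integral_nonneg fun _ => sq_nonneg _

variable {F : Measure (Cube p)} {x : (n : ℕ) → Fin n → Cube p} {ζ : Cube p → ℝ}
  {η : Cube p → Param d → ℝ} {Θ : Set (Param d)} {θ₀ : Param d}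

/-- The empirical norms are Lipschitz in θ with a constant free of n and converge pointwise, so the
limit inherits the constant. This lets the criterion extend continuously beyond Θ. -/
lemma exists_lipschitzOnWith_sqrt_popRisk (hη : SimulatorAssumption x η Θ θ₀)
    (hdesign : DesignAssumption F x ζ η Θ θ₀) :
    ∃ c₀ : ℝ≥0, LipschitzOnWith c₀ (fun θ => √(popRisk F ζ η θ)) Θ := by
  obtain ⟨c₀, hc₀, hlip⟩ := hη.lipschitz
  refine ⟨⟨c₀, hc₀.le⟩, LipschitzOnWith.of_dist_le_mul fun θ hθ θ' hθ' => ?_⟩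
  have hlim : ∀ θ ∈ Θ, Tendsto (fun n => empNorm (x n) (fun t => ζ t - η t θ)) atTop
      (𝓝 (√(popRisk F ζ η θ))) := by
    intro θ hθ
    have := (Real.continuous_sqrt.tendsto _).comp (hdesign.risk.tendsto_at hθ)
    refine this.congr fun n => ?_
    simp [Real.sqrt_sq (empNorm_nonneg _ _)]
  refine le_of_tendsto ((hlim θ hθ).dist (hlim θ' hθ')) ?_
  filter_upwards [eventually_ge_atTop 1] with n hn
  rw [Real.dist_eq, dist_eq_norm]
  refine le_trans ?_ (hlip n hn θ hθ θ' hθ')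
  have h1 := empNorm_sub_le (x n) (fun t => ζ t - η t θ) (fun t => ζ t - η t θ') (fun _ => 0)
  have h2 := empNorm_sub_le (x n) (fun t => ζ t - η t θ') (fun t => ζ t - η t θ) (fun _ => 0)
  simp only [sub_zero, sub_sub_sub_cancel_left] at h1 h2
  rw [empNorm_sub_comm (x n) (fun t => η t θ')] at h1
  rw [abs_le]
  constructor <;> linarith

/-- The minimum of the population criterion is well separated. -/
lemma IsTrueParam.exists_separation (hθ₀ : IsTrueParam F ζ η Θ θ₀)
    (hΘ : ∃ R₀ : ℝ, 0 < R₀ ∧ ∀ θ ∈ Θ, ‖θ‖ ≤ R₀) (hη : SimulatorAssumption x η Θ θ₀)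
    (hdesign : DesignAssumption F x ζ η Θ θ₀) {r : ℝ} (hr : 0 < r) :
    ∃ κ : ℝ, 0 < κ ∧ ∀ θ ∈ Θ, r ≤ ‖θ - θ₀‖ → popRisk F ζ η θ₀ + κ ≤ popRisk F ζ η θ := by
  by_contra! hcon
  obtain ⟨c₀, hlip⟩ := exists_lipschitzOnWith_sqrt_popRisk hη hdesign
  obtain ⟨R₀, -, hR₀⟩ := hΘ
  -- A sequence violating separation accumulates at some θ' in the closure of Θ, possibly outside Θ;
  -- the extension g gives the limiting value there. Uniqueness rules out θ' ∈ Θ and `not_tendsto`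
  -- rules out the rest.
  obtain ⟨g, hg, hfg⟩ := hlip.extend_real
  choose u huΘ hur hu using fun k : ℕ => hcon (1 / ((k : ℝ) + 1)) (by positivity)
  have hlim : Tendsto (fun k => popRisk F ζ η (u k)) atTop (𝓝 (popRisk F ζ η θ₀)) := by
    refine tendsto_of_tendsto_of_tendsto_of_le_of_le' tendsto_const_nhds
      (?_ : Tendsto (fun k : ℕ => popRisk F ζ η θ₀ + 1 / ((k : ℝ) + 1)) atTop _)
      (Eventually.of_forall fun k => ?_) (Eventually.of_forall fun k => (hu k).le)
    · simpa using tendsto_one_div_add_atTop_nhds_zero_nat.const_add (popRisk F ζ η θ₀)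
    · by_cases h : u k = θ₀
      · rw [h]
      · exact (hθ₀.lt_of_ne _ (huΘ k) h).le
  have hbdd : Bornology.IsBounded Θ := isBounded_iff_forall_norm_le.2 ⟨R₀, hR₀⟩
  obtain ⟨θ', hθ', φ, hφ, hconv⟩ := tendsto_subseq_of_bounded hbdd huΘ
  have hg' : g θ' = √(popRisk F ζ η θ₀) := by
    have h1 : Tendsto (fun k => g (u (φ k))) atTop (𝓝 (g θ')) :=
      (hg.continuous.tendsto θ').comp hconv
    have h2 : Tendsto (fun k => g (u (φ k))) atTop (𝓝 (√(popRisk F ζ η θ₀))) := by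
      refine ((Real.continuous_sqrt.tendsto _).comp (hlim.comp hφ.tendsto_atTop)).congr fun k => ?_
      exact hfg (huΘ _)
    exact tendsto_nhds_unique h1 h2
  by_cases hmem : θ' ∈ Θ
  · have h1 : r ≤ ‖θ' - θ₀‖ :=
      ge_of_tendsto' (hconv.sub_const θ₀).norm fun k => hur (φ k)
    have hne : θ' ≠ θ₀ := by
      rintro rfl
      rw [sub_self, norm_zero] at h1
      exact absurd hr h1.not_gt
    have h2 : √(popRisk F ζ η θ') = √(popRisk F ζ η θ₀) := (hfg hmem).trans hg'
    rw [Real.sqrt_inj (popRisk_nonneg _ _ _ _) (popRisk_nonneg _ _ _ _)] at h2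
    exact absurd h2 (hθ₀.lt_of_ne _ hmem hne).ne'
  · refine hθ₀.not_tendsto θ' ⟨hθ', hmem⟩ ?_
    have h1 : Tendsto (fun θ => g θ ^ 2) (𝓝[Θ] θ') (𝓝 (g θ' ^ 2)) :=
      ((hg.continuous.pow 2).tendsto θ').mono_left nhdsWithin_le_nhds
    rw [hg', Real.sq_sqrt (popRisk_nonneg _ _ _ _)] at h1
    refine h1.congr' ?_
    filter_upwards [self_mem_nhdsWithin] with θ hθ
    rw [← hfg hθ, Real.sq_sqrt (popRisk_nonneg _ _ _ _)]

variable {Ω : Type*} [MeasurableSpace Ω] {P : Measure Ω} {ε : (n : ℕ) → Fin n → Ω → ℝ}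

lemma tendsto_sqrt_natCast_atTop : Tendsto (fun n : ℕ => √(n : ℝ)) atTop atTop :=
  Real.tendsto_sqrt_atTop.comp tendsto_natCast_atTop_atTop

/-- Consistency of the least squares estimator. -/
lemma eventually_measure_le_norm_sub_le [IsProbabilityMeasure P]
    (hθ₀ : IsTrueParam F ζ η Θ θ₀) (herr : ErrorAssumption P ε)
    (hΘ : ∃ R₀ : ℝ, 0 < R₀ ∧ ∀ θ ∈ Θ, ‖θ‖ ≤ R₀) (hη : SimulatorAssumption x η Θ θ₀)
    (hdesign : DesignAssumption F x ζ η Θ θ₀) {θhat : ℕ → Ω → Param d}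
    (hθhat : ∀ n, 1 ≤ n → ∀ᵐ ω ∂P,
      IsLeastSquares (x n) (fun i => response x ζ ε n i ω) η Θ (θhat n ω))
    {r : ℝ} (hr : 0 < r) {e : ℝ} (he : 0 < e) :
    ∀ᶠ n in atTop, P {ω | r ≤ ‖θhat n ω - θ₀‖} ≤ ENNReal.ofReal e := by
  obtain ⟨σ, hσ, hsub⟩ := herr.exists_hasSubgaussianMGF
  obtain ⟨κ, hκ, hsep⟩ := hθ₀.exists_separation hΘ hη hdesign hr
  obtain ⟨T, hT, hTP⟩ := herr.exists_measure_sqrt_le (half_pos he)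
  obtain ⟨c₀, hc₀, hlip⟩ := hη.lipschitz
  obtain ⟨R₀, hR₀pos, hR₀⟩ := hΘ
  have hbdd : Bornology.IsBounded Θ := isBounded_iff_forall_norm_le.2 ⟨R₀, hR₀⟩
  -- Tail bounds control the noise at the net points, Cauchy–Schwarz between them, each up to κ/16.
  -- The basic inequality then caps the empirical gap at κ/4, whereas the uniform error κ/4 of the
  -- risk leaves a gap above κ/2.
  obtain ⟨S, hSΘ, hSfin, hScover⟩ :=
    Metric.finite_approx_of_totallyBounded
      (hbdd.isCompact_closure.totallyBounded.subset subset_closure) (κ / (16 * T * c₀)) (by positivity)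
  have : Fintype S := hSfin.fintype
  obtain ⟨C, hC, hCP⟩ := exists_measure_exists_empInner_le (X := Cube p) herr.indep hsub hσ
    (ι := S) (R := c₀ * (2 * R₀)) (by positivity) (half_pos he)
  have hrisk := Metric.tendstoUniformlyOn_iff.1 hdesign.risk (κ / 4) (by positivity)
  filter_upwards [hrisk, eventually_ge_atTop 1,
    tendsto_sqrt_natCast_atTop.eventually_ge_atTop (16 * C / κ)] with n hn hn1 hnC
  have hpos : 0 < √(n : ℝ) := Real.sqrt_pos.2 (by exact_mod_cast hn1)
  have hnorm : ∀ s : S, empNorm (x n) (fun t => η t s - η t θ₀) ≤ c₀ * (2 * R₀) := by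
    intro s
    refine (hlip n hn1 s (hSΘ s.2) θ₀ hθ₀.mem).trans ?_
    have h1 := norm_sub_le (s : Param d) θ₀
    have h2 := hR₀ s (hSΘ s.2)
    have h3 := hR₀ θ₀ hθ₀.mem
    gcongr
    linarith
  refine (measure_le_add_of_ae_imp ?_).trans
    ((add_le_add (hTP n) (hCP n (x n) _ hnorm)).trans (le_of_eq ?_))
  · filter_upwards [hθhat n hn1] with ω hω hfar
    by_contra hnot
    simp only [not_or, not_exists, not_lt] at hnot
    obtain ⟨hnoise, hnet⟩ := hnot
    have hbasic := IsLeastSquares.basic_inequality (e := fun i => ε n i ω) hω hθ₀.mem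
    have hgap := hsep _ hω.1 hfar
    have h1 := hn _ hω.1
    have h2 := hn _ hθ₀.mem
    rw [Real.dist_eq, abs_lt] at h1 h2
    obtain ⟨s, hs, hdist⟩ := Set.mem_iUnion₂.1 (hScover hω.1)
    rw [Metric.mem_ball, dist_eq_norm] at hdist
    have h3 := hnet ⟨s, hs⟩
    have h4 : |empInner (x n) (fun i => ε n i ω) (fun t => η t s - η t θ₀)| ≤ κ / 16 := by
      have h5 : 16 * C / κ * (κ / 16) ≤ √n * (κ / 16) := by gcongr
      have h6 : 16 * C / κ * (κ / 16) = C := by field_simp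
      exact le_of_mul_le_mul_left (h3.trans (h6 ▸ h5)) hpos
    have h7 : |empInner (x n) (fun i => ε n i ω) (fun t => η t (θhat n ω) - η t s)|
        ≤ κ / 16 := by
      refine (abs_empInner_le _ _ _).trans ?_
      calc _ ≤ T * (c₀ * ‖θhat n ω - s‖) := by
            gcongr
            · exact empNorm_nonneg _ _
            · exact hlip n hn1 _ hω.1 s (hSΘ hs)
        _ ≤ T * (c₀ * (κ / (16 * T * c₀))) := by gcongr
        _ = κ / 16 := by field_simp
    rw [empInner_sub] at h4 h7 hbasic
    have h8 := (abs_le.1 h4).2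
    have h9 := (abs_le.1 h7).2
    linarith [h1.1, h1.2, h2.1, h2.2]
  · rw [← ENNReal.ofReal_add (by positivity) (by positivity), add_halves]

end Consistency

/-! ### Quadratic forms on the parameter space -/

section QuadraticForms

variable {d : ℕ}

/-- The quadratic form of a matrix on the parameter space. -/
noncomputable def quadForm (M : Matrix (Fin d) (Fin d) ℝ) (h : Param d) : ℝ :=
  ∑ j, ∑ k, h j * h k * M j k

lemma abs_coord_le (h : Param d) (j : Fin d) : |h j| ≤ ‖h‖ := by
  simpa using PiLp.norm_apply_le h j

lemma quadForm_sub (M N : Matrix (Fin d) (Fin d) ℝ) (h : Param d) :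
    quadForm (M - N) h = quadForm M h - quadForm N h := by
  simp only [quadForm, Matrix.sub_apply, mul_sub, Finset.sum_sub_distrib]

lemma abs_quadForm_le {M : Matrix (Fin d) (Fin d) ℝ} {b : ℝ} (hM : ∀ j k, |M j k| ≤ b)
    (h : Param d) : |quadForm M h| ≤ (d : ℝ) ^ 2 * b * ‖h‖ ^ 2 := by
  calc |quadForm M h| ≤ ∑ j, ∑ k, |h j * h k * M j k| :=
        (Finset.abs_sum_le_sum_abs _ _).trans
          (Finset.sum_le_sum fun j _ => Finset.abs_sum_le_sum_abs _ _)
    _ ≤ ∑ _j : Fin d, ∑ _k : Fin d, ‖h‖ * ‖h‖ * b := by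
        refine Finset.sum_le_sum fun j _ => Finset.sum_le_sum fun k _ => ?_
        rw [abs_mul, abs_mul]
        gcongr
        · exact abs_coord_le h j
        · exact abs_coord_le h k
        · exact hM j k
    _ = _ := by
        simp only [Finset.sum_const, Finset.card_univ, Fintype.card_fin, nsmul_eq_mul]
        ring

/-- The constant is the minimum of the form on the compact unit sphere, extended by homogeneity. The
sphere is empty when d = 0, and then any constant works. -/
lemma exists_le_quadForm {A : Matrix (Fin d) (Fin d) ℝ} (hA : A.PosDef) :
    ∃ c : ℝ, 0 < c ∧ ∀ h : Param d, c * ‖h‖ ^ 2 ≤ quadForm A h := by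
  have hpos : ∀ h : Param d, h ≠ 0 → 0 < quadForm A h := by
    intro h hh
    have h1 := hA.dotProduct_mulVec_pos (x := fun j => h j) (by
      intro h0
      apply hh
      ext j
      exact congrFun h0 j)
    refine h1.trans_eq ?_
    simp only [quadForm, dotProduct, Matrix.mulVec, Pi.star_apply, star_trivial, Finset.mul_sum]
    exact Finset.sum_congr rfl fun j _ => Finset.sum_congr rfl fun k _ => by ring
  have hcont : Continuous fun h : Param d => quadForm A h := by
    unfold quadForm
    fun_prop
  have hsmul : ∀ (a : ℝ) (h : Param d), quadForm A (a • h) = a ^ 2 * quadForm A h := by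
    intro a h
    simp only [quadForm, PiLp.smul_apply, smul_eq_mul, Finset.mul_sum]
    exact Finset.sum_congr rfl fun j _ => Finset.sum_congr rfl fun k _ => by ring
  rcases (Metric.sphere (0 : Param d) 1).eq_empty_or_nonempty with hempty | hne
  · refine ⟨1, one_pos, fun h => ?_⟩
    have h0 : h = 0 := by
      by_contra hh
      have : ‖h‖⁻¹ • h ∈ Metric.sphere (0 : Param d) 1 := by
        rw [mem_sphere_zero_iff_norm, norm_smul, norm_inv, norm_norm,
          inv_mul_cancel₀ (norm_ne_zero_iff.2 hh)]
      rw [hempty] at this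
      exact this
    rw [h0]
    simp [quadForm]
  · obtain ⟨m, hm, hmin⟩ := (isCompact_sphere (0 : Param d) 1).exists_isMinOn hne
      hcont.continuousOn
    have hm0 : m ≠ 0 := by
      rintro rfl
      simp at hm
    refine ⟨quadForm A m, hpos m hm0, fun h => ?_⟩
    by_cases hh : h = 0
    · rw [hh]
      simp [quadForm]
    have hn : ‖h‖ ≠ 0 := norm_ne_zero_iff.2 hh
    have h1 : ‖h‖⁻¹ • h ∈ Metric.sphere (0 : Param d) 1 := by
      rw [mem_sphere_zero_iff_norm, norm_smul, norm_inv, norm_norm, inv_mul_cancel₀ hn]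
    have h2 : quadForm A m ≤ quadForm A (‖h‖⁻¹ • h) := hmin h1
    rw [hsmul, inv_pow, ← div_eq_inv_mul, le_div_iff₀ (by positivity)] at h2
    exact h2

end QuadraticForms

/-! ### Second-order Taylor expansion, uniformly in the input -/

section Taylor

variable {p d : ℕ} {η : Cube p → Param d → ℝ} {θ₀ : Param d}

lemma inner_grad (η : Cube p → Param d → ℝ) (θ : Param d) (t : Cube p) (h : Param d) :
    inner ℝ (grad η θ t) h = fderiv ℝ (η t) θ h := by
  rw [grad, gradient, InnerProductSpace.toDual_symm_apply]

lemma quadForm_hess (η : Cube p → Param d → ℝ) (θ : Param d) (t : Cube p) (h : Param d) :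
    quadForm (hess η θ t) h = fderiv ℝ (fderiv ℝ (η t)) θ h h := by
  have hsum : h = ∑ j, h j • EuclideanSpace.single j (1 : ℝ) := by
    simpa using ((EuclideanSpace.basisFun (Fin d) ℝ).sum_repr h).symm
  conv_rhs => rw [hsum]
  simp only [map_sum, map_smul, sum_apply, smul_apply,
    smul_eq_mul, quadForm, hess, Matrix.of_apply, Finset.mul_sum]
  rw [Finset.sum_comm]
  exact Finset.sum_congr rfl fun j _ => Finset.sum_congr rfl fun k _ => by ring

/-- Taylor expansion to second order, with a remainder controlled by the oscillation of the second
derivative. -/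
lemma abs_taylor_remainder_le {U : Set (Param d)} (hU : IsOpen U) {t : Cube p}
    (hη : ContDiffOn ℝ 2 (η t) U) {r b : ℝ} (hr : Metric.ball θ₀ r ⊆ U)
    (hb : ∀ θ ∈ Metric.ball θ₀ r, ∀ j k, |hess η θ t j k - hess η θ₀ t j k| ≤ b)
    {θ : Param d} (hθ : θ ∈ Metric.ball θ₀ r) :
    |η t θ - η t θ₀ - inner ℝ (grad η θ₀ t) (θ - θ₀) - quadForm (hess η θ₀ t) (θ - θ₀) / 2|
      ≤ (d : ℝ) ^ 2 * b * ‖θ - θ₀‖ ^ 2 := by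
  set h := θ - θ₀ with hh
  set c := (d : ℝ) ^ 2 * b * ‖h‖ ^ 2 with hc
  have hmem : ∀ s ∈ Set.Icc (0 : ℝ) 1, θ₀ + s • h ∈ Metric.ball θ₀ r := by
    intro s hs
    rw [Metric.mem_ball, dist_eq_norm] at hθ ⊢
    rw [add_sub_cancel_left, norm_smul, Real.norm_eq_abs, abs_of_nonneg hs.1]
    refine lt_of_le_of_lt ?_ hθ
    exact mul_le_of_le_one_left (norm_nonneg _) hs.2
  have hline : ∀ s : ℝ, HasDerivAt (fun s : ℝ => θ₀ + s • h) h s := fun s => by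
    simpa using ((hasDerivAt_id s).smul_const h).const_add θ₀
  have hd1 : ∀ s ∈ Set.Icc (0 : ℝ) 1,
      HasDerivAt (fun s : ℝ => η t (θ₀ + s • h)) (fderiv ℝ (η t) (θ₀ + s • h) h) s := by
    intro s hs
    have h1 : ContDiffAt ℝ 2 (η t) (θ₀ + s • h) :=
      hη.contDiffAt (hU.mem_nhds (hr (hmem s hs)))
    exact (h1.differentiableAt (by norm_num)).hasFDerivAt.comp_hasDerivAt s (hline s)
  have hd2 : ∀ s ∈ Set.Icc (0 : ℝ) 1,
      HasDerivAt (fun s : ℝ => fderiv ℝ (η t) (θ₀ + s • h) h)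
        (quadForm (hess η (θ₀ + s • h) t) h) s := by
    intro s hs
    have h1 : ContDiffAt ℝ 2 (η t) (θ₀ + s • h) :=
      hη.contDiffAt (hU.mem_nhds (hr (hmem s hs)))
    have h2 : ContDiffAt ℝ 1 (fderiv ℝ (η t)) (θ₀ + s • h) := h1.fderiv_right (by norm_num)
    have h3 := (h2.differentiableAt (by norm_num)).hasFDerivAt.comp_hasDerivAt s (hline s)
    rw [quadForm_hess]
    simpa using h3.clm_apply (hasDerivAt_const s h)
  have hosc : ∀ s ∈ Set.Icc (0 : ℝ) 1,
      |quadForm (hess η (θ₀ + s • h) t) h - quadForm (hess η θ₀ t) h| ≤ c := by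
    intro s hs
    rw [← quadForm_sub]
    exact abs_quadForm_le (fun j k => hb _ (hmem s hs) j k) h
  -- The sign of b is not assumed; c bounds an absolute value.
  have hc0 : 0 ≤ c := (abs_nonneg _).trans (hosc 0 (by simp))
  -- The mean value inequality is applied twice on the unit segment, each time to the function minus
  -- its quadratic model. A factor 1/2 in the remainder is given away.
  have hfirst : ∀ s ∈ Set.Icc (0 : ℝ) 1,
      |fderiv ℝ (η t) (θ₀ + s • h) h - fderiv ℝ (η t) θ₀ h - s * quadForm (hess η θ₀ t) h|
        ≤ c := by
    intro s hs
    have h1 := norm_image_sub_le_of_norm_deriv_le_segment'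
      (f := fun s => fderiv ℝ (η t) (θ₀ + s • h) h - s * quadForm (hess η θ₀ t) h) (C := c)
      (fun u hu => ((hd2 u hu).sub
        ((hasDerivAt_id u).mul_const (quadForm (hess η θ₀ t) h))).hasDerivWithinAt)
      (fun u hu => by
        rw [Real.norm_eq_abs, one_mul]
        exact hosc u (Set.Ico_subset_Icc_self hu)) s hs
    rw [Real.norm_eq_abs] at h1
    simp only [zero_smul, add_zero, zero_mul, sub_zero] at h1
    rw [sub_right_comm]
    exact h1.trans (mul_le_of_le_one_right hc0 hs.2)
  have h2 := norm_image_sub_le_of_norm_deriv_le_segment'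
    (f := fun s => η t (θ₀ + s • h) - s * fderiv ℝ (η t) θ₀ h
      - s ^ 2 * (quadForm (hess η θ₀ t) h / 2)) (C := c)
    (fun u hu => (((hd1 u hu).sub ((hasDerivAt_id u).mul_const (fderiv ℝ (η t) θ₀ h))).sub
      ((hasDerivAt_pow 2 u).mul_const (quadForm (hess η θ₀ t) h / 2))).hasDerivWithinAt)
    (fun u hu => by
      rw [Real.norm_eq_abs]
      refine le_trans (le_of_eq ?_) (hfirst u (Set.Ico_subset_Icc_self hu))
      congr 1
      push_cast
      ring) 1 (by simp)
  rw [Real.norm_eq_abs] at h2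
  refine le_trans (le_of_eq ?_) (h2.trans (by simp))
  rw [inner_grad]
  congr 1
  simp only [one_smul, zero_smul, add_zero, hh, add_sub_cancel]
  ring

/-- The second derivative is continuous at `θ₀`, uniformly over the input space. -/
lemma exists_radius_hess_sub_le {U : Set (Param d)} (hU : IsOpen U) (hθ₀ : θ₀ ∈ U)
    (hcont : ContinuousOn (fun q : Cube p × Param d => hess η q.2 q.1) (Set.univ ×ˢ U))
    {b : ℝ} (hb : 0 < b) :
    ∃ r : ℝ, 0 < r ∧ Metric.ball θ₀ r ⊆ U ∧
      ∀ t, ∀ θ ∈ Metric.ball θ₀ r, ∀ j k, |hess η θ t j k - hess η θ₀ t j k| ≤ b := by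
  obtain ⟨ρ, hρ, hball⟩ := Metric.isOpen_iff.1 hU θ₀ hθ₀
  have hsub : Metric.closedBall θ₀ (ρ / 2) ⊆ U :=
    (Metric.closedBall_subset_ball (half_lt_self hρ)).trans hball
  -- Compactness of the cube times a closed ball gives uniform continuity, hence a radius that does
  -- not depend on t.
  have hcompact : IsCompact ((Set.univ : Set (Cube p)) ×ˢ Metric.closedBall θ₀ (ρ / 2)) :=
    isCompact_univ.prod (isCompact_closedBall θ₀ (ρ / 2))
  have hunif : ∀ j k, ∃ r : ℝ, 0 < r ∧ ∀ t, ∀ θ ∈ Metric.closedBall θ₀ (ρ / 2),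
      θ ∈ Metric.ball θ₀ r → |hess η θ t j k - hess η θ₀ t j k| ≤ b := by
    intro j k
    have h1 : ContinuousOn (fun q : Cube p × Param d => hess η q.2 q.1 j k)
        (Set.univ ×ˢ Metric.closedBall θ₀ (ρ / 2)) :=
      (continuous_apply_apply j k).comp_continuousOn
        (hcont.mono (Set.prod_mono le_rfl hsub))
    obtain ⟨r, hr, h2⟩ := Metric.uniformContinuousOn_iff.1
      (hcompact.uniformContinuousOn_of_continuous h1) b hb
    refine ⟨r, hr, fun t θ hθ hθr => ?_⟩
    have h3 := h2 (t, θ) ⟨trivial, hθ⟩ (t, θ₀)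
      ⟨trivial, Metric.mem_closedBall_self (half_pos hρ).le⟩ (by
        rw [Prod.dist_eq, dist_self]
        exact max_lt hr hθr)
    exact h3.le
  choose r hr hrb using hunif
  have hmin : ∃ r' : ℝ, 0 < r' ∧ r' ≤ ρ / 2 ∧ ∀ j k, r' ≤ r j k := by
    have h1 : ∀ᶠ r' in 𝓝[>] (0 : ℝ), 0 < r' ∧ r' ≤ ρ / 2 ∧ ∀ j k, r' ≤ r j k := by
      refine Filter.Eventually.and self_mem_nhdsWithin (Filter.Eventually.and
        (nhdsWithin_le_nhds (eventually_le_nhds (half_pos hρ))) (nhdsWithin_le_nhds ?_))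
      exact eventually_all.2 fun j => eventually_all.2 fun k => eventually_le_nhds (hr j k)
    exact h1.exists
  obtain ⟨r', hr', hr'ρ, hr'r⟩ := hmin
  have hsub' : Metric.ball θ₀ r' ⊆ Metric.closedBall θ₀ (ρ / 2) :=
    (Metric.ball_subset_ball hr'ρ).trans Metric.ball_subset_closedBall
  exact ⟨r', hr', hsub'.trans hsub, fun t θ hθ j k =>
    hrb j k t θ (hsub' hθ) (Metric.ball_subset_ball (hr'r j k) hθ)⟩

end Taylor

/-! ### The root-n rate of the least squares estimator -/

section Rate

variable {p d : ℕ}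

lemma average_le {n : ℕ} {f : Fin n → ℝ} {E : ℝ} (hE : 0 ≤ E) (hf : ∀ i, f i ≤ E) :
    (n : ℝ)⁻¹ * ∑ i, f i ≤ E := by
  calc (n : ℝ)⁻¹ * ∑ i, f i ≤ (n : ℝ)⁻¹ * ∑ _i : Fin n, E := by
        gcongr with i
        exact hf i
    _ = ((n : ℝ)⁻¹ * n) * E := by
        rw [Finset.sum_const, Finset.card_univ, Fintype.card_fin, nsmul_eq_mul, mul_assoc]
    _ ≤ E := mul_le_of_le_one_left hE inv_mul_le_one

lemma inner_eq_sum (a h : Param d) : inner ℝ a h = ∑ j, h j * a j := by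
  simp [PiLp.inner_apply]

lemma quadForm_empHess {n : ℕ} (x : Fin n → Cube p) (ζ : Cube p → ℝ) (η : Cube p → Param d → ℝ)
    (θ₀ h : Param d) :
    quadForm (empHess x ζ η θ₀) h = (n : ℝ)⁻¹ * ∑ i, (inner ℝ (grad η θ₀ (x i)) h ^ 2
      - discrepancy ζ η θ₀ (x i) * quadForm (hess η θ₀ (x i)) h) := by
  have h1 : ∀ t, inner ℝ (grad η θ₀ t) h ^ 2 - discrepancy ζ η θ₀ t * quadForm (hess η θ₀ t) h
      = ∑ j, ∑ k, h j * h k * (grad η θ₀ t j * grad η θ₀ t k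
        - discrepancy ζ η θ₀ t * hess η θ₀ t j k) := by
    intro t
    rw [inner_eq_sum, sq, Finset.sum_mul_sum, quadForm, Finset.mul_sum, ← Finset.sum_sub_distrib]
    refine Finset.sum_congr rfl fun j _ => ?_
    rw [Finset.mul_sum, ← Finset.sum_sub_distrib]
    exact Finset.sum_congr rfl fun k _ => by ring
  simp_rw [h1]
  rw [Finset.sum_comm, Finset.mul_sum, quadForm]
  refine Finset.sum_congr rfl fun j _ => ?_
  rw [Finset.sum_comm, Finset.mul_sum]
  refine Finset.sum_congr rfl fun k _ => ?_
  rw [empHess, Matrix.of_apply, ← Finset.mul_sum]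
  ring

/-- Taking h out of the random sum reduces the noise in all directions h to d fixed functions;
`empInner_quadForm` does the same for the second-order term. -/
lemma empInner_inner {n : ℕ} (x : Fin n → Cube p) (e : Fin n → ℝ) (g : Cube p → Param d)
    (h : Param d) :
    empInner x e (fun t => inner ℝ (g t) h) = ∑ j, h j * empInner x e (fun t => g t j) := by
  simp only [empInner, inner_eq_sum, Finset.mul_sum]
  rw [Finset.sum_comm]
  exact Finset.sum_congr rfl fun j _ => Finset.sum_congr rfl fun i _ => by ring

lemma empInner_quadForm {n : ℕ} (x : Fin n → Cube p) (e : Fin n → ℝ)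
    (M : Cube p → Matrix (Fin d) (Fin d) ℝ) (h : Param d) :
    empInner x e (fun t => quadForm (M t) h)
      = quadForm (Matrix.of fun j k => empInner x e (fun t => M t j k)) h := by
  simp only [empInner, quadForm, Finset.mul_sum, Matrix.of_apply]
  rw [Finset.sum_comm]
  refine Finset.sum_congr rfl fun j _ => ?_
  rw [Finset.sum_comm]
  exact Finset.sum_congr rfl fun k _ => Finset.sum_congr rfl fun i _ => by ring

/-- The local quadratic lower bound for the least squares criterion, combined with the basic
inequality. -/
lemma norm_sub_le_of_basic_inequality {n : ℕ} {x : Fin n → Cube p} {e : Fin n → ℝ}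
    {ζ : Cube p → ℝ} {η : Cube p → Param d → ℝ} {θ θ₀ : Param d}
    {A : Matrix (Fin d) (Fin d) ℝ} {B C T Z b c ρ s w : ℝ}
    (hB : ∀ t, |discrepancy ζ η θ₀ t| ≤ B) (hgrad : ∀ t, ‖grad η θ₀ t‖ ≤ C)
    (hhess : ∀ t j k, |hess η θ₀ t j k| ≤ C)
    (hb₁ : b ≤ 1) (hρ₁ : ρ ≤ 1) (hs : 0 < s) (hb₀ : 0 ≤ b)
    (htaylor : ∀ t, |η t θ - η t θ₀ - inner ℝ (grad η θ₀ t) (θ - θ₀)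
      - quadForm (hess η θ₀ t) (θ - θ₀) / 2| ≤ b * ‖θ - θ₀‖ ^ 2)
    (hθ : ‖θ - θ₀‖ ≤ ρ)
    (hbasic : empNorm x (fun t => ζ t - η t θ) ^ 2 - empNorm x (fun t => ζ t - η t θ₀) ^ 2
      ≤ 2 * empInner x e (fun t => η t θ - η t θ₀))
    (hA : c * ‖θ - θ₀‖ ^ 2 ≤ quadForm A (θ - θ₀))
    (hAn : ∀ j k, |empHess x ζ η θ₀ j k - A j k| ≤ b)
    (hT : √((n : ℝ)⁻¹ * ∑ i, e i ^ 2) ≤ T)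
    (hZ₁ : ∀ j, s * |empInner x e (fun t => grad η θ₀ t j)| ≤ Z)
    (hZ₂ : ∀ j k, s * |empInner x e (fun t => hess η θ₀ t j k)| ≤ Z)
    (hw : ‖(n : ℝ)⁻¹ • ∑ i, discrepancy ζ η θ₀ (x i) • grad η θ₀ (x i)‖ ≤ w / s) :
    (c - (d ^ 2 + 2 * T + 2 * B) * b - d ^ 2 * Z / s
        - (d ^ 2 * C + 1) * (2 * C + (d ^ 2 * C + 1)) * ρ) * ‖θ - θ₀‖ ^ 2
      ≤ (2 * w + 2 * d * Z) / s * ‖θ - θ₀‖ := by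
  set h := θ - θ₀ with hh
  have hh0 : 0 ≤ ‖h‖ := norm_nonneg h
  let t₀ : Cube p := ⟨0, by simp⟩
  have hB0 : 0 ≤ B := (abs_nonneg _).trans (hB t₀)
  have hC0 : 0 ≤ C := (norm_nonneg _).trans (hgrad t₀)
  set lin : Cube p → ℝ := fun t => inner ℝ (grad η θ₀ t) h with hlin
  set quad : Cube p → ℝ := fun t => quadForm (hess η θ₀ t) h with hquad
  set rem : Cube p → ℝ := fun t => η t θ - η t θ₀ - lin t - quad t / 2 with hrem
  set q : ℝ := d ^ 2 * C + 1 with hq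
  have hq0 : 0 ≤ q := by positivity
  have hlin_le : ∀ t, |lin t| ≤ C * ‖h‖ := fun t =>
    (abs_real_inner_le_norm _ _).trans (mul_le_mul_of_nonneg_right (hgrad t) hh0)
  have hquad_le : ∀ t, |quad t| ≤ d ^ 2 * C * ‖h‖ ^ 2 := fun t => abs_quadForm_le (hhess t) h
  have hrem_le : ∀ t, |rem t| ≤ b * ‖h‖ ^ 2 := htaylor
  -- With D = η(·, θ) - η(·, θ₀) = lin + quad/2 + rem, the criterion difference averages D² - 2δ₀D
  -- and the form of A_n averages lin² - δ₀ quad. What is left over is the bias term, the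
  -- third-order lin² - D², and 2δ₀ rem.
  have hcrit : quadForm (empHess x ζ η θ₀) h
      = (empNorm x (fun t => ζ t - η t θ) ^ 2 - empNorm x (fun t => ζ t - η t θ₀) ^ 2)
        + 2 * inner ℝ ((n : ℝ)⁻¹ • ∑ i, discrepancy ζ η θ₀ (x i) • grad η θ₀ (x i)) h
        + (n : ℝ)⁻¹ * ∑ i, (lin (x i) ^ 2 - (η (x i) θ - η (x i) θ₀) ^ 2
          + 2 * (discrepancy ζ η θ₀ (x i) * rem (x i))) := by
    rw [quadForm_empHess, empNorm_sq, empNorm_sq, real_inner_smul_left, sum_inner,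
      mul_left_comm, ← mul_sub, ← mul_add, ← mul_add]
    congr 1
    rw [Finset.mul_sum, ← Finset.sum_sub_distrib, ← Finset.sum_add_distrib,
      ← Finset.sum_add_distrib]
    refine Finset.sum_congr rfl fun i _ => ?_
    rw [real_inner_smul_left]
    simp only [hrem, hquad, hlin, discrepancy]
    ring
  have hremainder : (n : ℝ)⁻¹ * ∑ i, (lin (x i) ^ 2 - (η (x i) θ - η (x i) θ₀) ^ 2
          + 2 * (discrepancy ζ η θ₀ (x i) * rem (x i)))
      ≤ q * (2 * C + q) * ρ * ‖h‖ ^ 2 + 2 * (B * (b * ‖h‖ ^ 2)) := by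
    have hρ0 : 0 ≤ ρ := hh0.trans hθ
    refine average_le (by positivity) fun i => add_le_add ?_ ?_
    · set D := η (x i) θ - η (x i) θ₀ with hD
      have h1 : |lin (x i) - D| ≤ q * ‖h‖ ^ 2 := by
        have h2 : lin (x i) - D = -(quad (x i) / 2 + rem (x i)) := by
          simp only [hrem, hD]
          ring
        rw [h2, abs_neg]
        refine (abs_add_le _ _).trans ?_
        rw [abs_div, abs_two, hq, add_mul]
        have h3 : b * ‖h‖ ^ 2 ≤ 1 * ‖h‖ ^ 2 := by gcongr
        linarith [hquad_le (x i), hrem_le (x i), abs_nonneg (quad (x i))]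
      have h2 : |lin (x i) + D| ≤ (2 * C + q) * ‖h‖ := by
        have h3 : lin (x i) + D = 2 * lin (x i) - (lin (x i) - D) := by ring
        rw [h3]
        refine (abs_sub _ _).trans ?_
        rw [abs_mul, abs_two]
        have h4 : q * ‖h‖ ^ 2 ≤ q * ‖h‖ := by
          rw [sq, ← mul_assoc]
          exact mul_le_of_le_one_right (by positivity) (hθ.trans hρ₁)
        linarith [hlin_le (x i)]
      calc lin (x i) ^ 2 - D ^ 2 = (lin (x i) - D) * (lin (x i) + D) := by ring
        _ ≤ |lin (x i) - D| * |lin (x i) + D| := by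
            rw [← abs_mul]
            exact le_abs_self _
        _ ≤ (q * ‖h‖ ^ 2) * ((2 * C + q) * ‖h‖) := by gcongr
        _ ≤ (q * ‖h‖ ^ 2) * ((2 * C + q) * ρ) := by gcongr
        _ = _ := by ring
    · refine mul_le_mul_of_nonneg_left ((le_abs_self _).trans ?_) zero_le_two
      rw [abs_mul]
      exact mul_le_mul (hB _) (hrem_le _) (abs_nonneg _) hB0
  have hbias : inner ℝ ((n : ℝ)⁻¹ • ∑ i, discrepancy ζ η θ₀ (x i) • grad η θ₀ (x i)) h
      ≤ w / s * ‖h‖ :=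
    (real_inner_le_norm _ _).trans (mul_le_mul_of_nonneg_right hw hh0)
  have hdecomp : empInner x e (fun t => η t θ - η t θ₀)
      = empInner x e lin + 2⁻¹ * empInner x e quad + empInner x e rem := by
    rw [← empInner_const_mul, ← empInner_add, ← empInner_add]
    congr 1
    ext t
    simp only [hrem]
    ring
  have hnoise₁ : empInner x e lin ≤ d * Z / s * ‖h‖ := by
    rw [hlin, empInner_inner]
    calc ∑ j, h j * empInner x e (fun t => grad η θ₀ t j)
        ≤ ∑ _j : Fin d, ‖h‖ * (Z / s) := by
          refine Finset.sum_le_sum fun j _ => (le_abs_self _).trans ?_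
          rw [abs_mul]
          refine mul_le_mul (abs_coord_le h j) ?_ (abs_nonneg _) hh0
          rw [le_div_iff₀ hs, mul_comm]
          exact hZ₁ j
      _ = _ := by
          rw [Finset.sum_const, Finset.card_univ, Fintype.card_fin, nsmul_eq_mul]
          ring
  have hnoise₂ : empInner x e quad ≤ d ^ 2 * (Z / s) * ‖h‖ ^ 2 := by
    rw [hquad, empInner_quadForm]
    refine (le_abs_self _).trans (abs_quadForm_le (fun j k => ?_) h)
    rw [Matrix.of_apply, le_div_iff₀ hs, mul_comm]
    exact hZ₂ j k
  -- The remainder depends on the random θ in no finite-dimensional way, so only Cauchy–Schwarz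
  -- applies; its smallness b compensates.
  have hnoise₃ : empInner x e rem ≤ T * (b * ‖h‖ ^ 2) := by
    refine (le_abs_self _).trans ((abs_empInner_le x e rem).trans ?_)
    exact mul_le_mul hT (empNorm_le_of_abs_le x (by positivity) hrem_le) (empNorm_nonneg _ _)
      ((Real.sqrt_nonneg _).trans hT)
  have hAn' : quadForm A h - d ^ 2 * b * ‖h‖ ^ 2 ≤ quadForm (empHess x ζ η θ₀) h := by
    have h1 := (abs_le.1 (abs_quadForm_le (M := empHess x ζ η θ₀ - A) hAn h)).1
    rw [quadForm_sub] at h1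
    linarith
  rw [hdecomp] at hbasic
  have e1 : d ^ 2 * (Z / s) * ‖h‖ ^ 2 = d ^ 2 * Z / s * ‖h‖ ^ 2 := by ring
  have e2 : (2 * w + 2 * d * Z) / s * ‖h‖ = 2 * (w / s * ‖h‖) + 2 * (d * Z / s * ‖h‖) := by ring
  rw [e2]
  rw [e1] at hnoise₂
  linarith

variable {F : Measure (Cube p)} {x : (n : ℕ) → Fin n → Cube p} {ζ : Cube p → ℝ}
  {η : Cube p → Param d → ℝ} {Θ : Set (Param d)} {θ₀ : Param d}
  {Ω : Type*} [MeasurableSpace Ω] {P : Measure Ω} {ε : (n : ℕ) → Fin n → Ω → ℝ}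

/-- The least squares estimator converges at the rate `n ^ (-1/2)`. -/
lemma exists_eventually_measure_sqrt_mul_norm_sub_le [IsProbabilityMeasure P]
    (hθ₀ : IsTrueParam F ζ η Θ θ₀) (herr : ErrorAssumption P ε)
    (hΘ : ∃ R₀ : ℝ, 0 < R₀ ∧ ∀ θ ∈ Θ, ‖θ‖ ≤ R₀) (hη : SimulatorAssumption x η Θ θ₀)
    (hdesign : DesignAssumption F x ζ η Θ θ₀) (hA : (popHess F ζ η θ₀).PosDef)
    (hδ₀ : ∃ B : ℝ, ∀ t, |discrepancy ζ η θ₀ t| ≤ B) {θhat : ℕ → Ω → Param d}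
    (hθhat : ∀ n, 1 ≤ n → ∀ᵐ ω ∂P,
      IsLeastSquares (x n) (fun i => response x ζ ε n i ω) η Θ (θhat n ω))
    {e : ℝ} (he : 0 < e) :
    ∃ C : ℝ, 0 < C ∧ ∀ᶠ n : ℕ in atTop,
      P {ω | C < √n * ‖θhat n ω - θ₀‖} ≤ ENNReal.ofReal e := by
  obtain ⟨σ, hσ, hsub⟩ := herr.exists_hasSubgaussianMGF
  obtain ⟨B, hB⟩ := hδ₀
  obtain ⟨U, hU, hθ₀U, hsmooth, -, hcont, C, hC⟩ := hη.smooth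
  let t₀ : Cube p := ⟨0, by simp⟩
  have hB0 : 0 ≤ B := (abs_nonneg _).trans (hB t₀)
  have hC0 : 0 ≤ C := (norm_nonneg _).trans (hC t₀ θ₀ hθ₀U).1
  obtain ⟨c, hc, hquad⟩ := exists_le_quadForm hA
  have he4 : 0 < e / 4 := by positivity
  obtain ⟨T, hT, hTP⟩ := herr.exists_measure_sqrt_le he4
  obtain ⟨Z₁, hZ₁, hZ₁P⟩ := exists_measure_exists_empInner_le (X := Cube p) herr.indep hsub hσ
    (ι := Fin d) (R := C + 1) (by positivity) he4
  obtain ⟨Z₂, hZ₂, hZ₂P⟩ := exists_measure_exists_empInner_le (X := Cube p) herr.indep hsub hσ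
    (ι := Fin d × Fin d) (R := C + 1) (by positivity) he4
  set Z : ℝ := max Z₁ Z₂ with hZ
  have hZpos : 0 < Z := lt_max_of_lt_left hZ₁
  obtain ⟨w, hw, hwn⟩ := hdesign.grad.exists_pos
  set L : ℝ := d ^ 2 + 2 * T + 2 * B with hL
  have hLpos : 0 < L := by positivity
  set Q : ℝ := (d ^ 2 * C + 1) * (2 * C + (d ^ 2 * C + 1)) with hQ
  have hQpos : 0 < Q := by positivity
  -- The constants b and ρ, and n large, each make one error term at most c/6, so that half of the
  -- curvature c survives.
  set b : ℝ := min 1 (c / (6 * L)) with hb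
  have hbpos : 0 < b := lt_min one_pos (by positivity)
  have hLb : L * b ≤ c / 6 := by
    calc L * b ≤ L * (c / (6 * L)) := by
          gcongr
          exact min_le_right _ _
      _ = c / 6 := by field_simp
  -- The Taylor bound multiplies the oscillation by d²; dividing by d² + 1 brings it below b, also
  -- for d = 0.
  obtain ⟨r, hr, hrU, hrosc⟩ := exists_radius_hess_sub_le hU hθ₀U hcont
    (b := b / (d ^ 2 + 1)) (by positivity)
  set ρ : ℝ := min (r / 2) (min 1 (c / (6 * Q))) with hρ
  have hρpos : 0 < ρ := lt_min (by positivity) (lt_min one_pos (by positivity))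
  have hQρ : Q * ρ ≤ c / 6 := by
    calc Q * ρ ≤ Q * (c / (6 * Q)) := by
          gcongr
          exact (min_le_right _ _).trans (min_le_right _ _)
      _ = c / 6 := by field_simp
  have hcons := eventually_measure_le_norm_sub_le hθ₀ herr hΘ hη hdesign hθhat hρpos he4
  have hhess : ∀ᶠ n in atTop, ∀ j k, |empHess (x n) ζ η θ₀ j k - popHess F ζ η θ₀ j k| ≤ b := by
    refine eventually_all.2 fun j => eventually_all.2 fun k => ?_
    filter_upwards [Metric.tendsto_nhds.1 (hdesign.hess j k) b hbpos] with n hn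
    exact hn.le
  -- Obtained by cancelling one factor ‖θhat - θ₀‖ against the remaining curvature c/2.
  refine ⟨2 * (2 * w + 2 * d * Z) / c, by positivity, ?_⟩
  filter_upwards [hcons, hhess, hwn.bound, eventually_ge_atTop 1,
    tendsto_sqrt_natCast_atTop.eventually_ge_atTop (6 * (d ^ 2 * Z) / c)]
    with n hn_cons hn_hess hn_grad hn1 hn_sqrt
  have hs : 0 < √(n : ℝ) := Real.sqrt_pos.2 (by exact_mod_cast hn1)
  have hZs : d ^ 2 * Z / √n ≤ c / 6 := by
    rw [div_le_iff₀ hc] at hn_sqrt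
    rw [div_le_iff₀ hs]
    linarith
  have hgradn : ‖(n : ℝ)⁻¹ • ∑ i, discrepancy ζ η θ₀ (x n i) • grad η θ₀ (x n i)‖ ≤ w / √n := by
    rw [norm_norm, Real.rpow_neg (by positivity), ← Real.sqrt_eq_rpow, norm_inv,
      Real.norm_of_nonneg hs.le] at hn_grad
    rwa [div_eq_mul_inv]
  have hnorm₁ : ∀ j : Fin d, empNorm (x n) (fun t => grad η θ₀ t j) ≤ C + 1 := fun j =>
    empNorm_le_of_abs_le _ (by positivity) fun t =>
      ((abs_coord_le _ j).trans (hC t θ₀ hθ₀U).1).trans (by linarith)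
  have hnorm₂ : ∀ j : Fin d × Fin d, empNorm (x n) (fun t => hess η θ₀ t j.1 j.2) ≤ C + 1 :=
    fun j => empNorm_le_of_abs_le _ (by positivity) fun t =>
      ((hC t θ₀ hθ₀U).2 j.1 j.2).trans (by linarith)
  have hmain : ∀ᵐ ω ∂P, 2 * (2 * w + 2 * d * Z) / c < √n * ‖θhat n ω - θ₀‖ →
      ρ ≤ ‖θhat n ω - θ₀‖ ∨ T < √((n : ℝ)⁻¹ * ∑ i, ε n i ω ^ 2) ∨
      (∃ j : Fin d, Z₁ < √n * |empInner (x n) (fun i => ε n i ω) (fun t => grad η θ₀ t j)|) ∨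
      ∃ j : Fin d × Fin d,
        Z₂ < √n * |empInner (x n) (fun i => ε n i ω) (fun t => hess η θ₀ t j.1 j.2)| := by
    filter_upwards [hθhat n hn1] with ω hω hlt
    by_contra! hnot
    obtain ⟨hclose, hnoise, hnoise₁, hnoise₂⟩ := hnot
    have hball : θhat n ω ∈ Metric.ball θ₀ r := by
      rw [Metric.mem_ball, dist_eq_norm]
      exact hclose.trans_le ((min_le_left _ _).trans (by linarith))
    have key := norm_sub_le_of_basic_inequality (s := √n) (Z := Z) (b := b) hB
      (fun t => (hC t θ₀ hθ₀U).1) (fun t => (hC t θ₀ hθ₀U).2) (min_le_left _ _)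
      ((min_le_right _ _).trans (min_le_left _ _)) hs hbpos.le
      (fun t => (abs_taylor_remainder_le hU (hsmooth t) hrU (hrosc t) hball).trans (by
        gcongr
        rw [mul_div_assoc', div_le_iff₀ (by positivity)]
        nlinarith))
      hclose.le (IsLeastSquares.basic_inequality (e := fun i => ε n i ω) hω hθ₀.mem)
      (hquad _) hn_hess hnoise (fun j => (hnoise₁ j).trans (le_max_left _ _))
      (fun j k => (hnoise₂ (j, k)).trans (le_max_right _ _)) hgradn
    have hpos : 0 < ‖θhat n ω - θ₀‖ := by
      have h1 : 0 < √n * ‖θhat n ω - θ₀‖ := lt_trans (by positivity) hlt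
      exact pos_of_mul_pos_right h1 hs.le
    have h1 : c / 2 * ‖θhat n ω - θ₀‖ ^ 2
        ≤ (2 * w + 2 * d * Z) / √n * ‖θhat n ω - θ₀‖ := by
      refine le_trans ?_ key
      gcongr
      linarith
    rw [sq, ← mul_assoc] at h1
    have h2 := le_of_mul_le_mul_right h1 hpos
    rw [le_div_iff₀ hs] at h2
    rw [div_lt_iff₀ hc] at hlt
    linarith
  refine (measure_le_add_of_ae_imp hmain).trans ?_
  refine (add_le_add hn_cons ((measure_le_add_of_ae_imp (ae_of_all _ fun _ h => h)).trans
    (add_le_add (hTP n) ((measure_le_add_of_ae_imp (ae_of_all _ fun _ h => h)).trans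
      (add_le_add (hZ₁P n (x n) _ hnorm₁) (hZ₂P n (x n) _ hnorm₂)))))).trans (le_of_eq ?_)
  rw [← ENNReal.ofReal_add he4.le he4.le, ← ENNReal.ofReal_add he4.le (by positivity),
    ← ENNReal.ofReal_add he4.le (by positivity)]
  congr 1
  ring

end Rate

/-! ### Balancing norm, penalty and noise -/

section Algebra

lemma exponent_pos {α v : ℝ} (hα₀ : 0 < α) (hv : 2 * α / (2 + α) < v) :
    0 < 2 * v - 2 * α + v * α := by
  rw [div_lt_iff₀ (by linarith)] at hv
  linarith

/-- The rate that results from balancing the squared norm and the penalty against the noise. -/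
lemma le_of_sq_add_penalty_le {α v X y l E : ℝ} (hα₀ : 0 < α) (hα₂ : α < 2)
    (hv : 2 * α / (2 + α) < v) (hX : 0 < X) (hy : 0 < y) (hl : 0 < l) (hE : 0 < E)
    (h : X ^ 2 + l ^ 2 * y ^ v ≤ E * (X ^ (1 - α / 2) * y ^ (α / 2))) :
    X ≤ E ^ (2 * v / (2 * v - 2 * α + v * α)) * l ^ (-(2 * α) / (2 * v - 2 * α + v * α)) := by
  have hD := exponent_pos hα₀ hv
  have hvα : α < 2 * v := by
    rw [div_lt_iff₀ (by linarith)] at hv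
    nlinarith
  have hlogR : Real.log (E * (X ^ (1 - α / 2) * y ^ (α / 2)))
      = Real.log E + ((1 - α / 2) * Real.log X + α / 2 * Real.log y) := by
    rw [Real.log_mul hE.ne' (by positivity), Real.log_mul (by positivity) (by positivity),
      Real.log_rpow hX, Real.log_rpow hy]
  have h1 : 2 * Real.log X ≤ Real.log E + ((1 - α / 2) * Real.log X + α / 2 * Real.log y) := by
    rw [← hlogR, ← Nat.cast_two, ← Real.log_pow]
    exact Real.log_le_log (by positivity) (le_trans (by simp; positivity) h)
  have h2 : 2 * Real.log l + v * Real.log y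
      ≤ Real.log E + ((1 - α / 2) * Real.log X + α / 2 * Real.log y) := by
    rw [← hlogR, ← Real.log_rpow hy, ← Nat.cast_two, ← Real.log_pow,
      ← Real.log_mul (by positivity) (by positivity)]
    exact Real.log_le_log (by positivity) (le_trans (by simp; positivity) h)
  -- Dropping either term on the left gives `h1` and `h2`, linear in the logarithms. The weights 2v
  -- - α and α eliminate log y.
  have h3 : (2 * v - 2 * α + v * α) * Real.log X
      ≤ 2 * v * Real.log E + -(2 * α) * Real.log l := by
    have h4 := mul_le_mul_of_nonneg_left h1 (sub_nonneg.2 hvα.le)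
    have h5 := mul_le_mul_of_nonneg_left h2 hα₀.le
    linarith
  rw [← Real.log_le_log_iff hX (by positivity), Real.log_mul (by positivity) (by positivity),
    Real.log_rpow hE, Real.log_rpow hl, div_mul_eq_mul_div, div_mul_eq_mul_div, ← add_div,
    le_div_iff₀ hD, mul_comm]
  exact h3

/-- For the regime where the penalty of the estimator is at most that of the target, so that only X
is unknown. -/
lemma le_rpow_of_sq_le {α X E : ℝ} (hα₀ : 0 < α) (hX : 0 < X)
    (h : X ^ 2 ≤ E * X ^ (1 - α / 2)) : X ≤ E ^ (2 / (2 + α)) := by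
  have h1 : X ^ (1 + α / 2) ≤ E := by
    have h2 : X ^ 2 = X ^ (1 + α / 2) * X ^ (1 - α / 2) := by
      rw [← Real.rpow_add hX, ← Real.rpow_natCast]
      congr 1
      push_cast
      ring
    rw [h2] at h
    exact le_of_mul_le_mul_right h (by positivity)
  calc X = (X ^ (1 + α / 2)) ^ (2 / (2 + α)) := by
        rw [← Real.rpow_mul hX.le, show (1 + α / 2) * (2 / (2 + α)) = 1 by field_simp,
          Real.rpow_one]
    _ ≤ E ^ (2 / (2 + α)) := Real.rpow_le_rpow (by positivity) h1 (by positivity)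

lemma div_sqrt_rpow {C : ℝ} (hC : 0 ≤ C) (n : ℕ) (s : ℝ) :
    (C / √n) ^ s = C ^ s * (n : ℝ) ^ (-(s / 2)) := by
  rw [Real.div_rpow hC (Real.sqrt_nonneg _), Real.sqrt_eq_rpow, ← Real.rpow_mul (Nat.cast_nonneg n),
    Real.rpow_neg (Nat.cast_nonneg n), div_eq_mul_inv]
  congr 3
  ring

end Algebra

/-! ### The penalized estimator -/

section Penalized

variable {p d : ℕ}

/-- The basic inequality of penalized least squares. -/
lemma IsPenalizedLeastSquares.basic_inequality {n : ℕ} {x : Fin n → Cube p} {ζ : Cube p → ℝ}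
    {e : Fin n → ℝ} {η : Cube p → Param d → ℝ} {θhat θ₀ : Param d} {H : Set (Cube p → ℝ)}
    {J : (Cube p → ℝ) → ℝ} {l v : ℝ} {δhat : Cube p → ℝ}
    (h : IsPenalizedLeastSquares x (fun i => ζ (x i) + e i) η θhat H J l v δhat)
    (hδ₀ : discrepancy ζ η θ₀ ∈ H) :
    empNorm x (fun t => δhat t - discrepancy ζ η θ₀ t) ^ 2 + l ^ 2 * J δhat ^ v
      ≤ 2 * empInner x e (fun t => δhat t - discrepancy ζ η θ₀ t)
        + 2 * (empNorm x (fun t => η t θhat - η t θ₀)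
          * empNorm x (fun t => δhat t - discrepancy ζ η θ₀ t))
        + l ^ 2 * J (discrepancy ζ η θ₀) ^ v := by
  have h1 := h.2 hδ₀
  simp only [Set.mem_ofPred_eq] at h1
  set f : Cube p → ℝ := fun t => δhat t - discrepancy ζ η θ₀ t with hf
  set D : Cube p → ℝ := fun t => η t θhat - η t θ₀ with hD
  have h2 : (n : ℝ)⁻¹ * ∑ i, (ζ (x i) + e i - η (x i) θhat - δhat (x i)) ^ 2
      = (n : ℝ)⁻¹ * ∑ i, (ζ (x i) + e i - η (x i) θhat - discrepancy ζ η θ₀ (x i)) ^ 2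
        + empNorm x f ^ 2 - 2 * empInner x e f + 2 * empInner x (fun i => D (x i)) f := by
    rw [empNorm_sq, empInner, empInner, mul_left_comm, mul_left_comm 2, ← mul_add, ← mul_sub,
      ← mul_add]
    congr 1
    rw [Finset.mul_sum, Finset.mul_sum, ← Finset.sum_add_distrib, ← Finset.sum_sub_distrib,
      ← Finset.sum_add_distrib]
    refine Finset.sum_congr rfl fun i _ => ?_
    simp only [hf, hD, discrepancy]
    ring
  -- The first-step error plays the role of a noise vector, bounded by Cauchy–Schwarz.
  have h3 : -(empNorm x D * empNorm x f) ≤ empInner x (fun i => D (x i)) f :=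
    (abs_le.1 (abs_empInner_le x (fun i => D (x i)) f)).1
  rw [h2] at h1
  linarith

variable {F : Measure (Cube p)} {x : (n : ℕ) → Fin n → Cube p} {ζ : Cube p → ℝ}
  {η : Cube p → Param d → ℝ} {Θ : Set (Param d)} {θ₀ : Param d}
  {Ω : Type*} [MeasurableSpace Ω] {P : Measure Ω} {ε : (n : ℕ) → Fin n → Ω → ℝ}

/-- A bound on the normalized class gives a bound on the noise term of `δ - δ₀`. -/
lemma abs_empInner_sub_le {X : Type*} {n : ℕ} {x : Fin n → X} {e : Fin n → ℝ} {H : Set (X → ℝ)}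
    {J : (X → ℝ) → ℝ} {δ δ₀ : X → ℝ} {C α : ℝ} (hδ : δ ∈ H) (hS : 0 < J δ + J δ₀)
    (h : ∀ γ ∈ normalizedClass H J δ₀, √n * |empInner x e γ| ≤ C * empNorm x γ ^ (1 - α / 2)) :
    √n * |empInner x e (fun t => δ t - δ₀ t)|
      ≤ C * (empNorm x (fun t => δ t - δ₀ t) ^ (1 - α / 2) * (J δ + J δ₀) ^ (α / 2)) := by
  set S := J δ + J δ₀ with hSdef
  have h1 := h _ ⟨δ, hδ, hS, rfl⟩
  have h2 : (fun t => (δ t - δ₀ t) / (J δ + J δ₀)) = fun t => S⁻¹ * (δ t - δ₀ t) := by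
    ext t
    rw [div_eq_inv_mul]
  rw [h2, empInner_const_mul x e S⁻¹ (fun t => δ t - δ₀ t),
    empNorm_const_mul x S⁻¹ (fun t => δ t - δ₀ t), abs_mul, abs_of_pos (inv_pos.2 hS),
    Real.mul_rpow (inv_pos.2 hS).le (empNorm_nonneg _ _)] at h1
  have h3 : S * S⁻¹ ^ (1 - α / 2) = S ^ (α / 2) := by
    rw [Real.inv_rpow hS.le, ← Real.rpow_neg hS.le]
    nth_rewrite 1 [← Real.rpow_one S]
    rw [← Real.rpow_add hS]
    congr 1
    ring
  have h4 := mul_le_mul_of_nonneg_left h1 hS.le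
  rw [← h3]
  calc _ = S * (√n * (S⁻¹ * |empInner x e (fun t => δ t - δ₀ t)|)) := by field_simp
    _ ≤ _ := h4
    _ = _ := by ring

/-- With high probability, the penalized least squares estimator satisfies a basic inequality in
which the noise is controlled by the entropy of the class. -/
lemma exists_eventually_measure_not_basic_le [IsProbabilityMeasure P]
    {H : Set (Cube p → ℝ)} {J : (Cube p → ℝ) → ℝ} {lam : ℕ → ℝ} {v K₁ α : ℝ}
    {θhat : ℕ → Ω → Param d} {δhat : ℕ → Ω → Cube p → ℝ}
    (hK₁ : 0 < K₁) (hα₀ : 0 < α) (hα₂ : α < 2)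
    (hθ₀ : IsTrueParam F ζ η Θ θ₀) (herr : ErrorAssumption P ε)
    (hΘ : ∃ R₀ : ℝ, 0 < R₀ ∧ ∀ θ ∈ Θ, ‖θ‖ ≤ R₀) (hη : SimulatorAssumption x η Θ θ₀)
    (hdesign : DesignAssumption F x ζ η Θ θ₀) (hA : (popHess F ζ η θ₀).PosDef)
    (hδ₀ : DiscrepancyAssumption x H J (discrepancy ζ η θ₀) K₁ α)
    (hθhat : ∀ n, 1 ≤ n → ∀ᵐ ω ∂P,
      IsLeastSquares (x n) (fun i => response x ζ ε n i ω) η Θ (θhat n ω))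
    (hδhat : ∀ n, 1 ≤ n → ∀ᵐ ω ∂P, IsPenalizedLeastSquares (x n)
      (fun i => response x ζ ε n i ω) η (θhat n ω) H J (lam n) v (δhat n ω))
    {e : ℝ} (he : 0 < e) :
    ∃ C : ℝ, 0 < C ∧ ∀ᶠ n : ℕ in atTop, P {ω | ¬ (δhat n ω ∈ H ∧
      (0 < J (δhat n ω) + J (discrepancy ζ η θ₀) →
        empNorm (x n) (fun t => δhat n ω t - discrepancy ζ η θ₀ t) ^ 2
            + lam n ^ 2 * J (δhat n ω) ^ v
          ≤ C / √n * (empNorm (x n) (fun t => δhat n ω t - discrepancy ζ η θ₀ t) ^ (1 - α / 2)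
              * (J (δhat n ω) + J (discrepancy ζ η θ₀)) ^ (α / 2))
            + C / √n * empNorm (x n) (fun t => δhat n ω t - discrepancy ζ η θ₀ t)
            + lam n ^ 2 * J (discrepancy ζ η θ₀) ^ v))} ≤ ENNReal.ofReal e := by
  obtain ⟨σ, hσ, hsub⟩ := herr.exists_hasSubgaussianMGF
  obtain ⟨c₀, hc₀, hlip⟩ := hη.lipschitz
  obtain ⟨R, hR⟩ := hδ₀.norm_le
  obtain ⟨C₁, hC₁, hrate⟩ := exists_eventually_measure_sqrt_mul_norm_sub_le hθ₀ herr hΘ hη hdesign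
    hA hδ₀.bounded hθhat (half_pos he)
  obtain ⟨C₂, hC₂, hmod⟩ := exists_measure_modulus_le (X := Cube p) herr.indep hsub hσ hK₁ hα₀ hα₂
    -- Chaining needs a positive radius, and R may fail to be positive.
    (R := max R 1) (lt_max_of_lt_right one_pos) (half_pos he)
  refine ⟨max (2 * (c₀ * C₁)) (2 * C₂), lt_max_of_lt_right (by positivity), ?_⟩
  filter_upwards [hrate, eventually_ge_atTop 1] with n hn hn1
  have hs : 0 < √(n : ℝ) := Real.sqrt_pos.2 (by exact_mod_cast hn1)
  have hclass := hmod n (x n) (normalizedClass H J (discrepancy ζ η θ₀))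
    (fun u hu => hδ₀.entropy_le u hu n hn1) (fun γ hγ => (hR n hn1 γ hγ).trans (le_max_left _ _))
  refine (measure_le_add_of_ae_imp ?_).trans ((add_le_add hn hclass).trans (le_of_eq ?_))
  · filter_upwards [hθhat n hn1, hδhat n hn1] with ω hω₁ hω₂ hnot
    by_contra! hgood
    obtain ⟨hg₁, hg₂⟩ := hgood
    refine hnot ⟨hω₂.1, fun hS => ?_⟩
    have hbasic := IsPenalizedLeastSquares.basic_inequality (e := fun i => ε n i ω) hω₂ hδ₀.mem
    have hnoise := abs_empInner_sub_le hω₂.1 hS hg₂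
    set f : Cube p → ℝ := fun t => δhat n ω t - discrepancy ζ η θ₀ t with hf
    have hf0 : 0 ≤ empNorm (x n) f := empNorm_nonneg _ _
    set W := empNorm (x n) f ^ (1 - α / 2)
      * (J (δhat n ω) + J (discrepancy ζ η θ₀)) ^ (α / 2) with hW
    have hW0 : 0 ≤ W := by positivity
    have h1 : empInner (x n) (fun i => ε n i ω) f ≤ C₂ / √n * W := by
      refine (le_abs_self _).trans ?_
      rw [div_mul_eq_mul_div, le_div_iff₀ hs, mul_comm]
      exact hnoise
    have h2 : empNorm (x n) (fun t => η t (θhat n ω) - η t θ₀) ≤ c₀ * C₁ / √n := by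
      refine (hlip n hn1 _ hω₁.1 _ hθ₀.mem).trans ?_
      rw [mul_div_assoc]
      gcongr
      rw [le_div_iff₀ hs, mul_comm]
      exact hg₁
    have h3 : 2 * (C₂ / √n * W) ≤ max (2 * (c₀ * C₁)) (2 * C₂) / √n * W := by
      rw [← mul_assoc, mul_div_assoc']
      gcongr
      exact le_max_right _ _
    have h4 : 2 * (c₀ * C₁ / √n * empNorm (x n) f)
        ≤ max (2 * (c₀ * C₁)) (2 * C₂) / √n * empNorm (x n) f := by
      rw [← mul_assoc, mul_div_assoc']
      gcongr
      exact le_max_left _ _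
    have h5 := mul_le_mul_of_nonneg_right h2 hf0
    linarith
  · rw [← ENNReal.ofReal_add (half_pos he).le (half_pos he).le, add_halves]

/-- Rates in probability follow from deterministic consequences of events of high probability. -/
lemma isBigOp_of_eventually {Y : ℕ → Ω → ℝ} {r : ℕ → ℝ} {good : ℝ → ℕ → Ω → Prop}
    (hgood : ∀ e : ℝ, 0 < e → ∃ C : ℝ, 0 < C ∧
      ∀ᶠ n in atTop, P {ω | ¬ good C n ω} ≤ ENNReal.ofReal e)
    (hY : ∀ C : ℝ, 0 < C → ∃ C' : ℝ, 0 < C' ∧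
      ∀ᶠ n in atTop, ∀ ω, good C n ω → |Y n ω| ≤ C' * r n) : IsBigOp P Y r := by
  intro e he
  obtain ⟨C, hC, h⟩ := hgood e he
  obtain ⟨C', hC', h'⟩ := hY C hC
  refine ⟨C', hC', ?_⟩
  filter_upwards [h, h'] with n hn hn'
  exact (measure_mono (t := {ω | ¬ good C n ω}) fun ω hω hg => absurd (hn' ω hg) (not_le.2 hω)).trans hn

/-- The deterministic bound when the penalty of the target vanishes. -/
lemma le_max_of_basic_inequality {α v X j l C : ℝ} {n : ℕ} (hα₀ : 0 < α) (hα₂ : α < 2)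
    (hv : 2 * α / (2 + α) < v) (hX : 0 ≤ X) (hj : 0 < j) (hl : 0 < l) (hC : 0 < C) (hn : 1 ≤ n)
    (h : X ^ 2 + l ^ 2 * j ^ v ≤ C / √n * (X ^ (1 - α / 2) * j ^ (α / 2)) + C / √n * X) :
    X ≤ max (2 * C) ((2 * C) ^ (2 * v / (2 * v - 2 * α + v * α)))
      * max ((n : ℝ) ^ (-(1 / 2) : ℝ)) (l ^ (-(2 * α) / (2 * v - 2 * α + v * α)) *
            (n : ℝ) ^ (-v / (2 * v - 2 * α + v * α))) := by
  have hs : 0 < √(n : ℝ) := Real.sqrt_pos.2 (by exact_mod_cast hn)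
  have hn0 : (0 : ℝ) < n := by exact_mod_cast hn
  rcases hX.eq_or_lt with rfl | hX
  · positivity
  -- If the first-step term dominates, X is of order n^(-1/2); if the noise dominates, balancing
  -- applies with E = 2C/√n.
  rcases le_total (C / √n * (X ^ (1 - α / 2) * j ^ (α / 2))) (C / √n * X) with hcase | hcase
  · have h1 : X * X ≤ 2 * C / √n * X := by
      have : 0 ≤ l ^ 2 * j ^ v := by positivity
      rw [mul_div_assoc, mul_assoc]
      nlinarith
    have h2 := le_of_mul_le_mul_right h1 hX
    refine h2.trans ?_
    rw [div_eq_mul_inv, Real.sqrt_eq_rpow, ← Real.rpow_neg hn0.le]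
    gcongr
    · exact le_max_left _ _
    · exact le_max_left _ _
  · have h1 : X ^ 2 + l ^ 2 * j ^ v ≤ 2 * C / √n * (X ^ (1 - α / 2) * j ^ (α / 2)) := by
      rw [mul_div_assoc, mul_assoc]
      linarith
    have h2 := le_of_sq_add_penalty_le hα₀ hα₂ hv hX hj hl (by positivity) h1
    rw [div_sqrt_rpow (by positivity), mul_assoc, mul_comm ((n : ℝ) ^ _)] at h2
    rw [show -(2 * v / (2 * v - 2 * α + v * α) / 2) = -v / (2 * v - 2 * α + v * α) by ring] at h2
    refine h2.trans ?_
    gcongr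
    · exact le_max_right _ _
    · exact le_max_right _ _

/-- The deterministic bound when the penalty of the target is positive. -/
lemma exists_le_of_basic_inequality {α v J₀ C c₁ c₂ : ℝ} (hα₀ : 0 < α) (hα₂ : α < 2)
    (hv : 2 * α / (2 + α) < v) (hJ₀ : 0 < J₀) (hC : 0 < C) (hc₁ : 0 < c₁) (hc₂ : 0 < c₂) :
    ∃ C' : ℝ, 0 < C' ∧ ∀ (n : ℕ) (X j l : ℝ), 1 ≤ n → 0 ≤ X → 0 ≤ j →
      c₁ * (n : ℝ) ^ (-1 / (2 + α)) ≤ l → l ≤ c₂ * (n : ℝ) ^ (-1 / (2 + α)) →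
      X ^ 2 + l ^ 2 * j ^ v ≤ C / √n * (X ^ (1 - α / 2) * (j + J₀) ^ (α / 2)) + C / √n * X
        + l ^ 2 * J₀ ^ v →
      X ≤ C' * (n : ℝ) ^ (-1 / (2 + α)) := by
  have hD := exponent_pos hα₀ hv
  have hv0 : 0 < v := lt_trans (by positivity) hv
  set D := 2 * v - 2 * α + v * α with hDdef
  -- One constant per regime: dominant target penalty, dominant first-step error, dominant noise
  -- with j ≤ J₀, dominant noise with j > J₀.
  set B₁ : ℝ := √(3 * J₀ ^ v) * c₂ with hB₁
  set B₂ : ℝ := 3 * C with hB₂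
  set B₃ : ℝ := (3 * C * (2 * J₀) ^ (α / 2)) ^ (2 / (2 + α)) with hB₃
  set B₄ : ℝ := (3 * C * 2 ^ (α / 2)) ^ (2 * v / D) * c₁ ^ (-(2 * α) / D) with hB₄
  have hB₁0 : 0 ≤ B₁ := by positivity
  have hB₂0 : 0 < B₂ := by positivity
  have hB₃0 : 0 ≤ B₃ := by positivity
  have hB₄0 : 0 ≤ B₄ := by positivity
  refine ⟨B₁ + B₂ + B₃ + B₄, by positivity, ?_⟩
  intro n X j l hn hX hj hl₁ hl₂ h
  have hs : 0 < √(n : ℝ) := Real.sqrt_pos.2 (by exact_mod_cast hn)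
  have hn0 : (0 : ℝ) < n := by exact_mod_cast hn
  set r : ℝ := (n : ℝ) ^ (-1 / (2 + α)) with hr
  have hr0 : 0 < r := by positivity
  have hl : 0 < l := lt_of_lt_of_le (by positivity) hl₁
  suffices hsuff : X ≤ B₁ * r ∨ X ≤ B₂ * r ∨ X ≤ B₃ * r ∨ X ≤ B₄ * r by
    have h1 : 0 ≤ B₁ * r := by positivity
    have h2 : 0 ≤ B₂ * r := by positivity
    have h3 : 0 ≤ B₃ * r := by positivity
    have h4 : 0 ≤ B₄ * r := by positivity
    rw [add_mul, add_mul, add_mul]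
    rcases hsuff with h | h | h | h <;> linarith
  rcases hX.eq_or_lt with rfl | hX
  · exact Or.inl (by positivity)
  have hpen : 0 ≤ l ^ 2 * j ^ v := by positivity
  set N := C / √n * (X ^ (1 - α / 2) * (j + J₀) ^ (α / 2)) with hN
  have hsplit : X ^ 2 + l ^ 2 * j ^ v ≤ 3 * (l ^ 2 * J₀ ^ v) ∨
      X ^ 2 + l ^ 2 * j ^ v ≤ 3 * (C / √n * X) ∨ X ^ 2 + l ^ 2 * j ^ v ≤ 3 * N := by
    by_contra! hcon
    linarith [hcon.1, hcon.2.1, hcon.2.2]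
  rcases hsplit with h1 | h1 | h1
  · left
    have h2 : X ≤ √(3 * J₀ ^ v * l ^ 2) := Real.le_sqrt_of_sq_le (by linarith)
    rw [Real.sqrt_mul (by positivity), Real.sqrt_sq hl.le] at h2
    refine h2.trans ?_
    rw [hB₁, mul_assoc]
    gcongr
  · right; left
    have h2 : X * X ≤ 3 * C / √n * X := by
      rw [mul_div_assoc, mul_assoc]
      linarith [sq X]
    have h3 := le_of_mul_le_mul_right h2 hX
    refine h3.trans ?_
    rw [div_eq_mul_inv, Real.sqrt_eq_rpow, ← Real.rpow_neg hn0.le]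
    gcongr
    refine Real.rpow_le_rpow_of_exponent_le (by exact_mod_cast hn) ?_
    rw [neg_div, neg_le_neg_iff]
    exact one_div_le_one_div_of_le two_pos (by linarith)
  · right; right
    rcases le_or_gt j J₀ with hjJ | hjJ
    · left
      have h2 : X ^ 2 ≤ 3 * C * (2 * J₀) ^ (α / 2) / √n * X ^ (1 - α / 2) := by
        have h3 : (j + J₀) ^ (α / 2) ≤ (2 * J₀) ^ (α / 2) := by
          gcongr
          linarith
        calc X ^ 2 ≤ 3 * N := by linarith
          _ ≤ 3 * (C / √n * (X ^ (1 - α / 2) * (2 * J₀) ^ (α / 2))) := by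
            rw [hN]
            gcongr
          _ = _ := by ring
      refine (le_rpow_of_sq_le hα₀ hX h2).trans (le_of_eq ?_)
      rw [div_sqrt_rpow (by positivity), hr]
      congr 2
      field_simp
    · right
      have hj0 : 0 < j := hJ₀.trans hjJ
      have h2 : X ^ 2 + l ^ 2 * j ^ v
          ≤ 3 * C * 2 ^ (α / 2) / √n * (X ^ (1 - α / 2) * j ^ (α / 2)) := by
        have h3 : (j + J₀) ^ (α / 2) ≤ (2 * j) ^ (α / 2) := by
          gcongr
          linarith
        calc X ^ 2 + l ^ 2 * j ^ v ≤ 3 * N := h1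
          _ ≤ 3 * (C / √n * (X ^ (1 - α / 2) * (2 * j) ^ (α / 2))) := by
            rw [hN]
            gcongr
          _ = _ := by
            rw [Real.mul_rpow zero_le_two hj]
            ring
      refine (le_of_sq_add_penalty_le hα₀ hα₂ hv hX hj0 hl (by positivity) h2).trans ?_
      rw [← hDdef, div_sqrt_rpow (by positivity)]
      -- The exponent is nonpositive, so the lower bound on l is the one needed; the upper bound
      -- serves the regime of B₁.
      have h4 : l ^ (-(2 * α) / D) ≤ (c₁ * r) ^ (-(2 * α) / D) :=
        Real.rpow_le_rpow_of_nonpos (by positivity) hl₁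
          (div_nonpos_of_nonpos_of_nonneg (by linarith) hD.le)
      -- Since D = v(2+α) - 2α, the exponents satisfy -v/D + 2α/((2+α)D) = -1/(2+α): this order of λ
      -- reproduces itself as the rate.
      have h5 : (n : ℝ) ^ (-(2 * v / D / 2)) * r ^ (-(2 * α) / D) = r := by
        rw [hr, ← Real.rpow_mul hn0.le, ← Real.rpow_add hn0]
        congr 1
        field_simp
        rw [hDdef]
        ring
      calc _ ≤ (3 * C * 2 ^ (α / 2)) ^ (2 * v / D) * (n : ℝ) ^ (-(2 * v / D / 2))
            * (c₁ * r) ^ (-(2 * α) / D) := by gcongr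
        _ = (3 * C * 2 ^ (α / 2)) ^ (2 * v / D) * c₁ ^ (-(2 * α) / D)
            * ((n : ℝ) ^ (-(2 * v / D / 2)) * r ^ (-(2 * α) / D)) := by
          rw [Real.mul_rpow hc₁.le hr0.le]
          ring
        _ = B₄ * r := by rw [h5]

end Penalized

end Calibration

/-! ### The two rates -/

theorem theorem2 {p d : ℕ} {Ω : Type*} [MeasurableSpace Ω]
    (P : Measure Ω) [IsProbabilityMeasure P]
    (F : Measure (Calibration.Cube p)) [IsProbabilityMeasure F]
    (ζ : Calibration.Cube p → ℝ)
    (η : Calibration.Cube p → Calibration.Param d → ℝ)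
    (Θ : Set (Calibration.Param d)) (θ₀ : Calibration.Param d)
    (x : (n : ℕ) → Fin n → Calibration.Cube p)
    (ε : (n : ℕ) → Fin n → Ω → ℝ)
    (H : Set (Calibration.Cube p → ℝ)) (J : (Calibration.Cube p → ℝ) → ℝ)
    (lam : ℕ → ℝ) (v K₁ α : ℝ)
    (θhat : ℕ → Ω → Calibration.Param d) (δhat : ℕ → Ω → Calibration.Cube p → ℝ)
    -- the class of discrepancies and the penalty
    (hH : Calibration.IsCone H) (hJ : Calibration.IsPseudoNormOn H J)
    (hlam : ∀ n, 0 < lam n)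
    (hK₁ : 0 < K₁) (hα₀ : 0 < α) (hα₂ : α < 2) (hv : 2 * α / (2 + α) < v)
    -- the true parameter and the assumptions
    (hθ₀ : Calibration.IsTrueParam F ζ η Θ θ₀)
    (herr : Calibration.ErrorAssumption P ε)
    (hΘ : ∃ R₀ : ℝ, 0 < R₀ ∧ ∀ θ ∈ Θ, ‖θ‖ ≤ R₀)
    (hη : Calibration.SimulatorAssumption x η Θ θ₀)
    (hdesign : Calibration.DesignAssumption F x ζ η Θ θ₀)
    (hA : (Calibration.popHess F ζ η θ₀).PosDef)
    (hδ₀ : Calibration.DiscrepancyAssumption x H J (Calibration.discrepancy ζ η θ₀) K₁ α)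
    -- the two-step estimator
    (hθhat : ∀ n, 1 ≤ n → ∀ᵐ ω ∂P, Calibration.IsLeastSquares (x n)
      (fun i => Calibration.response x ζ ε n i ω) η Θ (θhat n ω))
    (hδhat : ∀ n, 1 ≤ n → ∀ᵐ ω ∂P, Calibration.IsPenalizedLeastSquares (x n)
      (fun i => Calibration.response x ζ ε n i ω) η (θhat n ω) H J (lam n) v (δhat n ω)) :
    (0 < J (Calibration.discrepancy ζ η θ₀) →
      lam =Θ[atTop] (fun n : ℕ => (n : ℝ) ^ (-1 / (2 + α))) →
      Calibration.IsBigOp P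
        (fun n ω => Calibration.empNorm (x n)
          (fun t => δhat n ω t - Calibration.discrepancy ζ η θ₀ t))
        (fun n => (n : ℝ) ^ (-1 / (2 + α)))) ∧
    (J (Calibration.discrepancy ζ η θ₀) = 0 →
      (∀ δ ∈ H, δ ≠ Calibration.discrepancy ζ η θ₀ → 0 < J δ) →
      Calibration.IsBigOp P
        (fun n ω => Calibration.empNorm (x n)
          (fun t => δhat n ω t - Calibration.discrepancy ζ η θ₀ t))
        (fun n => max ((n : ℝ) ^ (-(1 / 2) : ℝ))
          (lam n ^ (-(2 * α) / (2 * v - 2 * α + v * α)) *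
            (n : ℝ) ^ (-v / (2 * v - 2 * α + v * α))))) := by
  have hmain := fun (e : ℝ) (he : 0 < e) =>
    Calibration.exists_eventually_measure_not_basic_le (e := e) hK₁ hα₀ hα₂ hθ₀ herr hΘ hη hdesign
      hA hδ₀ hθhat hδhat he
  set δ₀ := Calibration.discrepancy ζ η θ₀
  refine ⟨fun hJ₀ hrate => ?_, fun hJ₀ hJpos => ?_⟩
  · refine Calibration.isBigOp_of_eventually hmain fun C hC => ?_
    obtain ⟨c₂, hc₂, hle⟩ := hrate.1.exists_pos
    obtain ⟨c₁, hc₁, hge⟩ := hrate.2.exists_pos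
    obtain ⟨C', hC', hbound⟩ := Calibration.exists_le_of_basic_inequality hα₀ hα₂ hv hJ₀ hC
      (inv_pos.2 hc₁) hc₂
    refine ⟨C', hC', ?_⟩
    filter_upwards [hle.bound, hge.bound, eventually_ge_atTop 1] with n hn₂ hn₁ hn ω hω
    rw [Real.norm_of_nonneg (hlam n).le, Real.norm_of_nonneg (by positivity)] at hn₁ hn₂
    rw [abs_of_nonneg (Calibration.empNorm_nonneg _ _)]
    have hj := hJ.nonneg _ hω.1
    exact hbound n _ _ (lam n) hn (Calibration.empNorm_nonneg _ _) hj
      ((inv_mul_le_iff₀ hc₁).2 hn₁) hn₂ (hω.2 (by linarith))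
  · refine Calibration.isBigOp_of_eventually hmain fun C hC => ?_
    refine ⟨max (2 * C) ((2 * C) ^ (2 * v / (2 * v - 2 * α + v * α))),
      lt_max_of_lt_left (by positivity), ?_⟩
    filter_upwards [eventually_ge_atTop 1] with n hn ω hω
    rw [abs_of_nonneg (Calibration.empNorm_nonneg _ _)]
    -- When δhat = δ₀ the penalties sum to zero and the event gives no inequality, but the error
    -- itself is zero.
    by_cases heq : δhat n ω = δ₀
    · have h0 : Calibration.empNorm (x n) (fun t => δhat n ω t - δ₀ t) = 0 := by
        simp [heq, Calibration.empNorm]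
      rw [h0]
      positivity
    · have hj := hJpos _ hω.1 heq
      have hv0 : v ≠ 0 := (lt_trans (by positivity) hv).ne'
      have h := hω.2 (by linarith)
      rw [hJ₀, Real.zero_rpow hv0, mul_zero, add_zero, add_zero] at h
      exact Calibration.le_max_of_basic_inequality hα₀ hα₂ hv (Calibration.empNorm_nonneg _ _) hj
        (hlam n) hC hn h
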